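/- Let $p$ be a prime, $m\ge 1$ an integer, $v$ the $p$-adic valuation and $|\cdot|$ the $p$-adic norm on $\mathbb{Q}_p$, $|x|=p^{-v(x)}$. Let $dx$ be the Haar measure on $\mathbb{Q}_p$ with $\mathbb{Z}_p$ of measure $1$, let $d\mu^\times=dx/|x|$, let $E=\bigcup_{s=0}^{m-1}p^s\mathbb{Z}_p^\times$ (a fundamental domain of $\mathbb{Q}_p^\times/p^{m\mathbb{Z}}$), and put $V=\mu^\times(E)=m(1-p^{-1})$. Define $$D\phi(x)=\int_E\frac{\phi(z)-\phi(x)}{|z-x|^2}\,|x|\,dz ,$$ where $D$ acts on the first variable of a function of two variables. A symmetric Green's function for $D$ is a symmetric real function $G(x,y)$ on $E\times E$ that is continuous off the diagonal (the values on the diagonal are irrelevant), $\mu^\times$-integrable in $x$ for each $y$, and satisfies $DG(\cdot,y)=\delta_y-\frac1V$ as distributions on $E$, i.e. for every $y\in E$ and every locally constant $\phi:E\to\mathbb{R}$ $$\int_E G(x,y)\,D\phi(x)\,d\mu^\times(x)=\phi(y)-\frac1V\int_E\phi\,d\mu^\times .$$ For $x,y\in E$ and $n\geq 1$ put $d(x,y)=\dfrac{|x-y|}{\max(|x|,|y|)}$,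 $U(y)=|y|+p^{1-m}|y|^{-1}$, $$\lambda_0=\frac{p(p-1)}{p+1},\qquad \lambda_n(y)=U(y)^n\,\frac{p^{n+1}-1}{(p-1)(p+1)^n(p^n-1)}\,\lambda_0,\qquad A(y)=-\sum_{n\ge1}\lambda_n(y),$$ $$B(x,y)=A(y)+\lambda_0\log_p d(x,y)+\sum_{n\ge1}\lambda_n(y)\,d(x,y)^n\qquad(x\ne y).$$ Then: 1. There is a function $C(x,y)$ depending only on $|x|$ and $|y|$ such that $B+C$ is a symmetric Green's function for $D$; and for every symmetric Green's function $G$ for $D$ there is a function $C(x,y)$ depending only on $|x|$ and $|y|$ with $G(x,y)=B(x,y)+C(x,y)$ for all $x\neq y$ in $E$. 2. The series $\sum_{n\ge1}\lambda_n(y)$ and $\sum_{n\ge1}\lambda_n(y)d(x,y)^n$ converge absolutely for all $x,y\in E$. 3. For all $x\ne y$ in $E$ the integrals defining $DB(x,y)$, $D\log_p d(x,y)$ and $D\,d(x,y)^n$ ($n\ge1$) converge absolutely, the series $\sum_{n\ge1}\lambda_n(y)\,D\,d(x,y)^n$ converges absolutely, and $$DB(x,y)=\lambda_0\,D\log_p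 d(x,y)+\sum_{n\ge1}\lambda_n(y)\,D\,d(x,y)^n=-\lambda_0\,p^{-|v(x)-v(y)|}\,\frac{p+1}{(p-1)(p+1-U(y))} .$$ In particular, for $x\ne y$, $DB(x,y)$ depends only on $|x|$ and $|y|$. -/

import Mathlib

namespace TateCurve

/-- `ℚ_p` with its Borel σ-algebra. -/
noncomputable instance instMeasurableSpacePadic (p : ℕ) [Fact p.Prime] : MeasurableSpace ℚ_[p] :=
  borel ℚ_[p]

instance instBorelSpacePadic (p : ℕ) [Fact p.Prime] : BorelSpace ℚ_[p] := ⟨rfl⟩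

/-- `ℤ_p`, the closed unit ball of `ℚ_p`, as a compact set with non-empty interior. -/
def unitBall (p : ℕ) [Fact p.Prime] : TopologicalSpace.PositiveCompacts ℚ_[p] where
  carrier := Metric.closedBall 0 1
  isCompact' := isCompact_closedBall 0 1
  interior_nonempty' :=
    ⟨0, Metric.ball_subset_interior_closedBall (Metric.mem_ball_self one_pos)⟩

/-- The additive Haar measure `μ⁺ = dx` on `ℚ_p` with `μ⁺(ℤ_p) = 1`. -/
noncomputable def addHaar (p : ℕ) [Fact p.Prime] : MeasureTheory.Measure ℚ_[p] :=
  MeasureTheory.Measure.addHaarMeasure (unitBall p)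

/-- The multiplicative Haar measure `μ^× = dx / |x|`. -/
noncomputable def mulHaar (p : ℕ) [Fact p.Prime] : MeasureTheory.Measure ℚ_[p] :=
  (addHaar p).withDensity fun x => ENNReal.ofReal ‖x‖⁻¹

/-- The fundamental domain `E = ⋃_{s=0}^{m-1} p^s ℤ_p^×` of `ℚ_p^× / p^{mℤ}`. -/
def E (p : ℕ) [Fact p.Prime] (m : ℕ) : Set ℚ_[p] :=
  {x | ∃ s : ℕ, s < m ∧ ∃ u : ℤ_[p]ˣ, x = (p : ℚ_[p]) ^ s * ((u : ℤ_[p]) : ℚ_[p])}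

/-- The integrand `(φ(z) - φ(x)) |x| / |z - x|²` of `Dφ(x)`. -/
noncomputable def kernelD (p : ℕ) [Fact p.Prime] (φ : ℚ_[p] → ℝ) (x z : ℚ_[p]) : ℝ :=
  (φ z - φ x) / ‖z - x‖ ^ 2 * ‖x‖

/-- The flat Laplacian `Dφ(x) = ∫_E (φ(z) - φ(x)) / |z - x|² |x| dz`. -/
noncomputable def D (p : ℕ) [Fact p.Prime] (m : ℕ) (φ : ℚ_[p] → ℝ) (x : ℚ_[p]) : ℝ :=
  ∫ z in E p m, kernelD p φ x z ∂(addHaar p)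

/-- The integral that defines `Dφ(x)` converges absolutely. -/
def DConverges (p : ℕ) [Fact p.Prime] (m : ℕ) (φ : ℚ_[p] → ℝ) (x : ℚ_[p]) : Prop :=
  MeasureTheory.IntegrableOn (kernelD p φ x) (E p m) (addHaar p)

/-- A symmetric Green's function for `D`, as a function on `E × E` minus the diagonal (the values
on the diagonal, a null set in each variable, play no role): symmetric, continuous off the
diagonal, integrable in the first variable, and satisfying `D G(·, y) = δ_y - 1 / V`, `V = μ^×(E)`,
in the sense of distributions on `E` with respect to the pairing `⟨f, g⟩ = ∫_E f g dμ^×`, for which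
`D` is formally self-adjoint. Since `E` is open and closed, the locally constant functions on `E`
are the restrictions of those on `ℚ_p`. -/
structure IsGreen (p : ℕ) [Fact p.Prime] (m : ℕ) (G : ℚ_[p] → ℚ_[p] → ℝ) : Prop where
  symm : ∀ x ∈ E p m, ∀ y ∈ E p m, G x y = G y x
  continuousOn : ContinuousOn (fun w : ℚ_[p] × ℚ_[p] => G w.1 w.2)
    {w | w.1 ∈ E p m ∧ w.2 ∈ E p m ∧ w.1 ≠ w.2}
  integrableOn : ∀ y ∈ E p m,
    MeasureTheory.IntegrableOn (fun x => G x y) (E p m) (mulHaar p)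
  green : ∀ y ∈ E p m, ∀ φ : ℚ_[p] → ℝ, IsLocallyConstant φ →
    ∫ x in E p m, G x y * D p m φ x ∂(mulHaar p) =
      φ y - 1 / (mulHaar p).real (E p m) * ∫ x in E p m, φ x ∂(mulHaar p)

/-- `d(x, y) = |x - y| / max(|x|, |y|)`. -/
noncomputable def d (p : ℕ) [Fact p.Prime] (x y : ℚ_[p]) : ℝ := ‖x - y‖ / max ‖x‖ ‖y‖

/-- `U(y) = |y| + p^{1-m} |y|⁻¹`. -/
noncomputable def U (p : ℕ) [Fact p.Prime] (m : ℕ) (y : ℚ_[p]) : ℝ :=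
  ‖y‖ + (p : ℝ) ^ (1 - (m : ℤ)) * ‖y‖⁻¹

/-- `λ₀ = p (p - 1) / (p + 1)`. -/
noncomputable def lambda0 (p : ℕ) : ℝ := (p : ℝ) * ((p : ℝ) - 1) / ((p : ℝ) + 1)

/-- `λ_n(y)`; only used for `n ≥ 1`. -/
noncomputable def lambda (p : ℕ) [Fact p.Prime] (m n : ℕ) (y : ℚ_[p]) : ℝ :=
  U p m y ^ n * (((p : ℝ) ^ (n + 1) - 1) /
    (((p : ℝ) - 1) * ((p : ℝ) + 1) ^ n * ((p : ℝ) ^ n - 1))) * lambda0 p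

/-- `A(y) = -∑_{n ≥ 1} λ_n(y)`. -/
noncomputable def A (p : ℕ) [Fact p.Prime] (m : ℕ) (y : ℚ_[p]) : ℝ :=
  -∑' n : ℕ, lambda p m (n + 1) y

/-- `B(x, y) = A(y) + λ₀ log_p d(x, y) + ∑_{n ≥ 1} λ_n(y) d(x, y)^n`. -/
noncomputable def B (p : ℕ) [Fact p.Prime] (m : ℕ) (x y : ℚ_[p]) : ℝ :=
  A p m y + lambda0 p * Real.logb p (d p x y) +
    ∑' n : ℕ, lambda p m (n + 1) y * d p x y ^ (n + 1)

end TateCurve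

namespace TateCurve

open MeasureTheory Metric Filter Topology

/-! ### Balls, spheres and radial integrals in `ℚ_p`; the domain `E`. -/

section

variable {p : ℕ} [Fact p.Prime]

/-! For fixed `y` the function `B(·, y)` is radial about `y`: it depends only on `k`, where `d(x, y)
= p⁻ᵏ`, and takes values `g_k` with `g_0 = 0`. Integrals over `E` of radial functions are series
over spheres about `y`, minus the contribution of the small ball about `0` that `E` omits. Put `r =
U(y) / (p + 1)`. The coefficients `λ_n` are such that the increments sum to `g_{j+1} - g_j = -λ₀ /
((1 - r p⁻ʲ)(1 - r p⁻ʲ⁻¹))`, and `p⁻ʲ(g_{j+1} - g_j)` telescopes (`profile_succ_sub`,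
`profile_succ_sub_eq_tail`). Hence `DB(x, y)` does not see how close `x` is to `y`
(`sum_profile_add_tail`), and equals `-p^{-|v(x)-v(y)|} p / (p + 1 - U(y))` (`D_B_eq`).

On functions of `|x|` the operator `D` is the Laplacian of a weighted graph on the valuations `0, …,
m - 1`. There `(p + 1 - U(y)) / p` is a row sum of the weights (`sum_shellWeight`), so a diagonal
term plus a symmetric Green's matrix of the graph gives a symmetric `C(|x|, |y|)` with `D(B + C) =
-1/V` off the diagonal (`exists_shell_correction`).

This pointwise identity already contains the delta mass. A locally constant `φ` is constant on balls
of some radius `p⁻ᴺ`, and the pairing with `Dφ` is a finite sum with symmetric weights. Replacing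
`φ` by `φ - φ(y)` leaves `Dφ` unchanged and kills the ball around `y`, so only the values of `D(B +
C)` away from `y` matter (`setIntegral_mul_D_of_locallyConstant`).

For uniqueness, the difference of two Green's functions annihilates the image of `D`. Tested against
its own ball integrals it has zero Dirichlet energy, so these integrals agree for all balls of a
given radius; by continuity the difference is constant in `x` off `y`, and by symmetry the constant
does not depend on `y`. -/

instance instIsAddHaarAddHaar : (addHaar p).IsAddHaarMeasure := by
  unfold addHaar; infer_instance

theorem one_lt_cast_prime : (1 : ℝ) < p := by exact_mod_cast (Fact.out : p.Prime).one_lt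

theorem cast_prime_pos : (0 : ℝ) < p := zero_lt_one.trans one_lt_cast_prime

theorem inv_prime_pos : (0 : ℝ) < (p : ℝ)⁻¹ := inv_pos.2 cast_prime_pos

theorem inv_prime_lt_one : (p : ℝ)⁻¹ < 1 := inv_lt_one_of_one_lt₀ one_lt_cast_prime

theorem inv_pow_pos (k : ℕ) : (0 : ℝ) < (p : ℝ)⁻¹ ^ k := pow_pos inv_prime_pos k

theorem inv_pow_lt_iff {i j : ℕ} : (p : ℝ)⁻¹ ^ i < (p : ℝ)⁻¹ ^ j ↔ j < i :=
  pow_lt_pow_iff_right_of_lt_one₀ inv_prime_pos inv_prime_lt_one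

theorem inv_pow_le_iff {i j : ℕ} : (p : ℝ)⁻¹ ^ i ≤ (p : ℝ)⁻¹ ^ j ↔ j ≤ i :=
  pow_le_pow_iff_right_of_lt_one₀ inv_prime_pos inv_prime_lt_one

theorem inv_pow_inj {i j : ℕ} (h : (p : ℝ)⁻¹ ^ i = (p : ℝ)⁻¹ ^ j) : i = j :=
  le_antisymm (inv_pow_le_iff.1 h.ge) (inv_pow_le_iff.1 h.le)

/-- Two `p`-adic numbers at distance smaller than the norm of one have the same norm. -/
theorem norm_eq_of_norm_sub_lt {a b : ℚ_[p]} (h : ‖a - b‖ < ‖b‖) : ‖a‖ = ‖b‖ := by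
  have := IsUltrametricDist.norm_add_eq_max_of_norm_ne_norm h.ne
  rw [sub_add_cancel, max_eq_right h.le] at this
  exact this

theorem norm_sub_le_max' (a b : ℚ_[p]) : ‖a - b‖ ≤ max ‖a‖ ‖b‖ := by
  rw [sub_eq_add_neg, ← norm_neg b]
  exact IsUltrametricDist.norm_add_le_max _ _

theorem exists_norm_eq_inv_pow {z : ℚ_[p]} (hz : z ≠ 0) (h1 : ‖z‖ ≤ 1) :
    ∃ i : ℕ, ‖z‖ = (p : ℝ)⁻¹ ^ i := by
  have h := Padic.norm_eq_zpow_neg_valuation hz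
  have hv : 0 ≤ z.valuation := (Padic.norm_le_one_iff_val_nonneg z).1 h1
  obtain ⟨n, hn⟩ := Int.eq_ofNat_of_zero_le hv
  refine ⟨n, ?_⟩
  rw [h, hn, zpow_neg, inv_pow]; simp

theorem norm_le_inv_pow_succ {z : ℚ_[p]} {k : ℕ} (h : ‖z‖ < (p : ℝ)⁻¹ ^ k) :
    ‖z‖ ≤ (p : ℝ)⁻¹ ^ (k + 1) := by
  rcases eq_or_ne z 0 with rfl | hz
  · simp
  · obtain ⟨i, hi⟩ := exists_norm_eq_inv_pow hz
      (h.le.trans (pow_le_one₀ inv_prime_pos.le inv_prime_lt_one.le))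
    rw [hi] at h ⊢
    exact inv_pow_le_iff.2 (inv_pow_lt_iff.1 h)

theorem norm_prime_pow (k : ℕ) : ‖(p : ℚ_[p]) ^ k‖ = (p : ℝ)⁻¹ ^ k := by
  rw [norm_pow, Padic.norm_p]

theorem closedBall_eq_iUnion (k : ℕ) :
    closedBall (0 : ℚ_[p]) ((p : ℝ)⁻¹ ^ k) =
      ⋃ a ∈ Finset.range p, closedBall ((a : ℚ_[p]) * (p : ℚ_[p]) ^ k) ((p : ℝ)⁻¹ ^ (k + 1)) := by
  ext z
  simp only [Set.mem_iUnion, mem_closedBall, dist_eq_norm, sub_zero, Finset.mem_range, exists_prop]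
  have hp0 : (p : ℚ_[p]) ^ k ≠ 0 := pow_ne_zero _ (by exact_mod_cast (Fact.out : p.Prime).ne_zero)
  constructor
  · intro hz
    have hw : ‖z / (p : ℚ_[p]) ^ k‖ ≤ 1 := by
      rw [norm_div, norm_prime_pow]
      exact div_le_one_of_le₀ hz (inv_pow_pos k).le
    obtain ⟨a, ha, haw⟩ := PadicInt.exists_mem_range (⟨z / (p : ℚ_[p]) ^ k, hw⟩ : ℤ_[p])
    refine ⟨a, ha, ?_⟩
    have h1 := PadicInt.mem_nonunits.1 ((IsLocalRing.mem_maximalIdeal _).1 haw)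
    rw [PadicInt.norm_def] at h1
    have : z - a * (p : ℚ_[p]) ^ k = (z / (p : ℚ_[p]) ^ k - a) * (p : ℚ_[p]) ^ k := by
      field_simp
    refine norm_le_inv_pow_succ ?_
    rw [this, norm_mul, norm_prime_pow]
    exact mul_lt_of_lt_one_left (inv_pow_pos k) h1
  · rintro ⟨a, -, h⟩
    have h2 : ‖(a : ℚ_[p]) * (p : ℚ_[p]) ^ k‖ ≤ (p : ℝ)⁻¹ ^ k := by
      rw [norm_mul, norm_prime_pow]
      exact mul_le_of_le_one_left (inv_pow_pos k).le (by exact_mod_cast Padic.norm_int_le_one (a : ℤ))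
    have h3 := IsUltrametricDist.norm_add_le_max (z - a * (p : ℚ_[p]) ^ k) (a * (p : ℚ_[p]) ^ k)
    rw [sub_add_cancel] at h3
    exact h3.trans (max_le (h.trans (inv_pow_le_iff.2 k.le_succ)) h2)

/-- A ball of radius `p⁻ᵏ` is a disjoint union of `p` translates of a ball of radius `p⁻ᵏ⁻¹`, which
gives induction from the normalisation at `k = 0`. -/
theorem addHaar_closedBall (a : ℚ_[p]) (k : ℕ) :
    addHaar p (closedBall a ((p : ℝ)⁻¹ ^ k)) = ENNReal.ofReal ((p : ℝ)⁻¹ ^ k) := by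
  have key : ∀ (b : ℚ_[p]) (k : ℕ), addHaar p (closedBall b ((p : ℝ)⁻¹ ^ k)) =
      addHaar p (closedBall 0 ((p : ℝ)⁻¹ ^ k)) := by
    intro b k
    have := measure_preimage_add (addHaar p) (-b) (closedBall 0 ((p : ℝ)⁻¹ ^ k))
    rw [← this]
    congr 1
    ext z
    simp [dist_eq_norm, sub_eq_neg_add]
  rw [key]
  induction k with
  | zero =>
    have : addHaar p (unitBall p : Set ℚ_[p]) = 1 := Measure.addHaarMeasure_self
    rw [pow_zero, ENNReal.ofReal_one]
    exact this
  | succ k ih =>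
    rw [closedBall_eq_iUnion, measure_biUnion_finset] at ih
    · simp only [key, Finset.sum_const, Finset.card_range, nsmul_eq_mul] at ih
      have hp : (p : ENNReal) = ENNReal.ofReal p := by simp
      have h2 : ENNReal.ofReal ((p : ℝ)⁻¹ ^ k) =
          (p : ENNReal) * ENNReal.ofReal ((p : ℝ)⁻¹ ^ (k + 1)) := by
        rw [hp, ← ENNReal.ofReal_mul cast_prime_pos.le, pow_succ']
        rw [mul_inv_cancel_left₀ cast_prime_pos.ne']
      rw [h2] at ih
      exact (ENNReal.mul_right_inj (by exact_mod_cast (Fact.out : p.Prime).ne_zero)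
        (ENNReal.natCast_ne_top p)).1 ih
    · intro a ha b hb hab
      refine Set.disjoint_left.2 fun z hza hzb => ?_
      rw [mem_closedBall, dist_eq_norm] at hza hzb
      have h := norm_sub_le_max' (z - (b : ℚ_[p]) * (p : ℚ_[p]) ^ k)
        (z - (a : ℚ_[p]) * (p : ℚ_[p]) ^ k)
      have h1 := h.trans (max_le hzb hza)
      have h2 : z - (b : ℚ_[p]) * (p : ℚ_[p]) ^ k - (z - (a : ℚ_[p]) * (p : ℚ_[p]) ^ k) =
          (((a : ℤ) - (b : ℤ) : ℤ) : ℚ_[p]) * (p : ℚ_[p]) ^ k := by push_cast; ring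
      have h3 : ‖(((a : ℤ) - (b : ℤ) : ℤ) : ℚ_[p])‖ = 1 := by
        refine le_antisymm (Padic.norm_int_le_one _) (not_lt.1 fun hlt => ?_)
        rw [Padic.norm_intCast_lt_one_iff] at hlt
        simp only [Finset.coe_range, Set.mem_Iio] at ha hb
        have := Int.eq_zero_of_abs_lt_dvd hlt (by rw [abs_lt]; omega)
        omega
      rw [h2, norm_mul, h3, one_mul, norm_prime_pow] at h1
      have := inv_pow_le_iff.1 h1
      omega
    · intro a _
      exact isClosed_closedBall.measurableSet

theorem addHaar_real_closedBall (a : ℚ_[p]) (k : ℕ) :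
    (addHaar p).real (closedBall a ((p : ℝ)⁻¹ ^ k)) = (p : ℝ)⁻¹ ^ k := by
  rw [measureReal_def, addHaar_closedBall, ENNReal.toReal_ofReal (inv_pow_pos k).le]

theorem addHaar_closedBall_lt_top (a : ℚ_[p]) (r : ℝ) : addHaar p (closedBall a r) < ⊤ :=
  (isCompact_closedBall a r).measure_lt_top

theorem addHaar_singleton (y : ℚ_[p]) : addHaar p {y} = 0 := by
  refine le_antisymm (ge_of_tendsto' (x := atTop)
    (f := fun k : ℕ => ENNReal.ofReal ((p : ℝ)⁻¹ ^ k)) ?_ fun k => ?_) zero_le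
  · have := (ENNReal.continuous_ofReal.tendsto 0).comp
      (tendsto_pow_atTop_nhds_zero_of_lt_one inv_prime_pos.le (inv_prime_lt_one (p := p)))
    simpa [Function.comp_def] using this
  · rw [← addHaar_closedBall y k]
    exact measure_mono (Set.singleton_subset_iff.2 (mem_closedBall_self (inv_pow_pos k).le))

theorem addHaar_real_sphere (y : ℚ_[p]) (i : ℕ) :
    (addHaar p).real (sphere y ((p : ℝ)⁻¹ ^ i)) = (p : ℝ)⁻¹ ^ i * (1 - (p : ℝ)⁻¹) := by
  have h : sphere y ((p : ℝ)⁻¹ ^ i) =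
      closedBall y ((p : ℝ)⁻¹ ^ i) \ closedBall y ((p : ℝ)⁻¹ ^ (i + 1)) := by
    ext z
    simp only [mem_sphere, Set.mem_sdiff, mem_closedBall, not_le, dist_eq_norm]
    constructor
    · intro h; rw [h]; exact ⟨le_rfl, inv_pow_lt_iff.2 i.lt_succ_self⟩
    · rintro ⟨h1, h2⟩
      exact le_antisymm h1 (not_lt.1 fun h3 => h2.not_ge (norm_le_inv_pow_succ h3))
  rw [h, measureReal_sdiff (closedBall_subset_closedBall (inv_pow_le_iff.2 (Nat.le_add_right i 1)))
    isClosed_closedBall.measurableSet (addHaar_closedBall_lt_top _ _).ne,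
    addHaar_real_closedBall, addHaar_real_closedBall, pow_succ]
  ring

/-- A function that takes the value `c i` on the sphere of radius `p⁻ⁱ` about `y` is integrable
on the unit ball about `y` if `∑ |c i| p⁻ⁱ` converges, and its integral is the expected sum. -/
theorem integrableOn_and_hasSum_of_radial (y : ℚ_[p]) {f : ℚ_[p] → ℝ} {c : ℕ → ℝ}
    (hf : ∀ z i, ‖z - y‖ = (p : ℝ)⁻¹ ^ i → f z = c i)
    (hc : Summable fun i => |c i| * (p : ℝ)⁻¹ ^ i) :
    IntegrableOn f (closedBall y 1) (addHaar p) ∧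
      HasSum (fun i => c i * ((p : ℝ)⁻¹ ^ i * (1 - (p : ℝ)⁻¹)))
        (∫ z in closedBall y 1, f z ∂(addHaar p)) := by
  set S : ℕ → Set ℚ_[p] := fun i => sphere y ((p : ℝ)⁻¹ ^ i) with hS
  have hSm : ∀ i, MeasurableSet (S i) := fun i => isClosed_sphere.measurableSet
  have hfS : ∀ i, Set.EqOn f (fun _ => c i) (S i) := fun i z hz =>
    hf z i (by simpa [hS, dist_eq_norm] using hz)
  have hSt : ∀ i, addHaar p (S i) < ⊤ := fun i =>
    (measure_mono sphere_subset_closedBall).trans_lt (addHaar_closedBall_lt_top y _)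
  have hint : ∀ i, IntegrableOn f (S i) (addHaar p) := fun i =>
    (integrableOn_const (hSt i).ne).congr_fun (hfS i).symm (hSm i)
  have hval : ∀ i, ∫ z in S i, f z ∂(addHaar p) = c i * ((p : ℝ)⁻¹ ^ i * (1 - (p : ℝ)⁻¹)) := by
    intro i
    rw [setIntegral_congr_fun (hSm i) (hfS i), setIntegral_const, addHaar_real_sphere, smul_eq_mul,
      mul_comm]
  have hnorm : ∀ i, ∫ z in S i, ‖f z‖ ∂(addHaar p) =
      |c i| * (p : ℝ)⁻¹ ^ i * (1 - (p : ℝ)⁻¹) := by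
    intro i
    rw [setIntegral_congr_fun (g := fun _ => |c i|) (hSm i) (fun z hz => by simp [hfS i hz]),
      setIntegral_const, addHaar_real_sphere, smul_eq_mul]
    ring
  have hdisj : Pairwise (Function.onFun Disjoint S) := by
    intro i j hij
    refine Set.disjoint_left.2 fun z hi hj => hij (inv_pow_inj (p := p) ?_)
    rw [← mem_sphere.1 hi, ← mem_sphere.1 hj]
  -- The spheres miss only the centre, which is a null set.
  have hU : closedBall y 1 =ᵐ[addHaar p] ⋃ i, S i := by
    have hcup : closedBall y 1 = (⋃ i, S i) ∪ {y} := by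
      ext z
      simp only [mem_closedBall, Set.mem_union, Set.mem_iUnion, Set.mem_singleton_iff, hS,
        mem_sphere, dist_eq_norm]
      constructor
      · intro h
        rcases eq_or_ne z y with rfl | hz
        · exact Or.inr rfl
        · exact Or.inl (exists_norm_eq_inv_pow (sub_ne_zero.2 hz) h)
      · rintro (⟨i, hi⟩ | rfl)
        · rw [hi]; exact pow_le_one₀ inv_prime_pos.le inv_prime_lt_one.le
        · simp
    rw [hcup]
    exact union_ae_eq_left_of_ae_eq_empty (ae_eq_empty.2 (addHaar_singleton y))
  have hI : IntegrableOn f (⋃ i, S i) (addHaar p) :=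
    integrableOn_iUnion_of_summable_integral_norm hint
      ((hc.mul_right (1 - (p : ℝ)⁻¹)).congr fun i => (hnorm i).symm)
  refine ⟨hI.congr_set_ae hU, ?_⟩
  rw [setIntegral_congr_set hU]
  simpa only [hval] using hasSum_integral_iUnion hSm hdisj hI

theorem mem_E_iff {m : ℕ} {x : ℚ_[p]} : x ∈ E p m ↔ ∃ s < m, ‖x‖ = (p : ℝ)⁻¹ ^ s := by
  constructor
  · rintro ⟨s, hs, u, rfl⟩
    refine ⟨s, hs, ?_⟩
    rw [norm_mul, norm_prime_pow, ← PadicInt.norm_def, PadicInt.norm_units, mul_one]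
  · rintro ⟨s, hs, hx⟩
    have hp0 : (p : ℚ_[p]) ^ s ≠ 0 :=
      pow_ne_zero _ (by exact_mod_cast (Fact.out : p.Prime).ne_zero)
    have h1 : ‖x / (p : ℚ_[p]) ^ s‖ = 1 := by
      rw [norm_div, norm_prime_pow, hx, div_self (inv_pow_pos s).ne']
    refine ⟨s, hs, PadicInt.mkUnits h1, ?_⟩
    rw [PadicInt.mkUnits_eq]
    field_simp

theorem E_eq_diff (m : ℕ) :
    E p m = closedBall 0 1 \ closedBall 0 ((p : ℝ)⁻¹ ^ m) := by
  ext x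
  simp only [mem_E_iff, Set.mem_sdiff, mem_closedBall, dist_eq_norm, sub_zero, not_le]
  constructor
  · rintro ⟨s, hs, hx⟩
    rw [hx]
    exact ⟨pow_le_one₀ inv_prime_pos.le inv_prime_lt_one.le, inv_pow_lt_iff.2 hs⟩
  · rintro ⟨h1, h2⟩
    obtain ⟨i, hi⟩ := exists_norm_eq_inv_pow (norm_pos_iff.1 ((inv_pow_pos m).trans h2)) h1
    rw [hi] at h2
    exact ⟨i, inv_pow_lt_iff.1 h2, hi⟩

theorem measurableSet_E (m : ℕ) : MeasurableSet (E p m) := by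
  rw [E_eq_diff]
  exact isClosed_closedBall.measurableSet.diff isClosed_closedBall.measurableSet

theorem isCompact_E (m : ℕ) : IsCompact (E p m) := by
  rw [E_eq_diff]
  exact (isCompact_closedBall 0 1).diff (IsUltrametricDist.isOpen_closedBall _ (inv_pow_pos m).ne')

theorem E_subset_closedBall {m : ℕ} : E p m ⊆ closedBall 0 1 := by
  rw [E_eq_diff]; exact Set.sdiff_subset

theorem ne_zero_of_mem_E {m : ℕ} {x : ℚ_[p]} (hx : x ∈ E p m) : x ≠ 0 := by
  obtain ⟨s, -, hs⟩ := mem_E_iff.1 hx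
  rw [← norm_pos_iff, hs]; exact inv_pow_pos s

theorem norm_le_one_of_mem_E {m : ℕ} {x : ℚ_[p]} (hx : x ∈ E p m) : ‖x‖ ≤ 1 := by
  simpa using E_subset_closedBall hx

theorem inv_pow_lt_norm_of_mem_E {m : ℕ} {x : ℚ_[p]} (hx : x ∈ E p m) :
    (p : ℝ)⁻¹ ^ m < ‖x‖ := by
  rw [E_eq_diff] at hx; simpa using hx.2

theorem closedBall_one_eq {y : ℚ_[p]} (hy : ‖y‖ ≤ 1) :
    closedBall y 1 = closedBall (0 : ℚ_[p]) 1 :=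
  IsUltrametricDist.closedBall_eq_of_mem (by simpa using hy) |>.symm

theorem norm_sub_le_one {x y : ℚ_[p]} (hx : ‖x‖ ≤ 1) (hy : ‖y‖ ≤ 1) : ‖x - y‖ ≤ 1 :=
  (norm_sub_le_max' x y).trans (max_le hx hy)

theorem setIntegral_mulHaar (m : ℕ) (f : ℚ_[p] → ℝ) :
    ∫ x in E p m, f x ∂(mulHaar p) = ∫ x in E p m, ‖x‖⁻¹ * f x ∂(addHaar p) := by
  rw [mulHaar, setIntegral_withDensity_eq_setIntegral_toReal_smul
    (by fun_prop) (by simp) _ (measurableSet_E m)]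
  simp [ENNReal.toReal_ofReal]

/-- On `E` the density `|x|⁻¹` is bounded above and below. -/
theorem integrableOn_mulHaar_iff {m : ℕ} {f : ℚ_[p] → ℝ} :
    IntegrableOn f (E p m) (mulHaar p) ↔ IntegrableOn f (E p m) (addHaar p) := by
  have h1 : IntegrableOn f (E p m) (mulHaar p) ↔
      IntegrableOn (fun x => ‖x‖⁻¹ * f x) (E p m) (addHaar p) := by
    rw [IntegrableOn, mulHaar, restrict_withDensity (measurableSet_E m),
      integrable_withDensity_iff_integrable_smul' (by fun_prop) (by simp)]
    simp [ENNReal.toReal_ofReal, IntegrableOn]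
  rw [h1]
  constructor
  · intro h
    have h2 : IntegrableOn (fun x => ‖x‖ * (‖x‖⁻¹ * f x)) (E p m) (addHaar p) :=
      h.bdd_mul (c := 1) (by fun_prop) ((ae_restrict_iff' (measurableSet_E m)).2
        (Eventually.of_forall fun x hx => by simpa using norm_le_one_of_mem_E hx))
    refine h2.congr_fun (fun x hx => ?_) (measurableSet_E m)
    exact mul_inv_cancel_left₀ (norm_ne_zero_iff.2 (ne_zero_of_mem_E hx)) _
  · intro h
    refine h.bdd_mul (c := ((p : ℝ)⁻¹ ^ m)⁻¹) (by fun_prop)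
      ((ae_restrict_iff' (measurableSet_E m)).2 (Eventually.of_forall fun x hx => ?_))
    rw [norm_inv, norm_norm]
    exact inv_anti₀ (inv_pow_pos m) (inv_pow_lt_norm_of_mem_E hx).le

end

/-! ### The coefficients `λ_n` and the radial profile of `B`. -/

section

variable {p : ℕ} [Fact p.Prime] {m : ℕ} {y : ℚ_[p]}

theorem lambda0_pos : 0 < lambda0 p := by
  have := one_lt_cast_prime (p := p)
  unfold lambda0
  have h1 : (0 : ℝ) < (p : ℝ) - 1 := by linarith
  positivity

/-- The ratio `U(y) / (p + 1)` of the geometric series that governs `λ_n(y)`. -/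
noncomputable def ratio (p : ℕ) [Fact p.Prime] (m : ℕ) (y : ℚ_[p]) : ℝ := U p m y / ((p : ℝ) + 1)

theorem ratio_nonneg : 0 ≤ ratio p m y := by
  unfold ratio U; positivity

theorem U_eq {s : ℕ} (hs : s < m) (hy : ‖y‖ = (p : ℝ)⁻¹ ^ s) :
    U p m y = (p : ℝ)⁻¹ ^ s + (p : ℝ)⁻¹ ^ (m - 1 - s) := by
  have h0 : (p : ℝ) ≠ 0 := cast_prime_pos.ne'
  rw [U, hy]
  congr 1
  obtain ⟨k, rfl⟩ : ∃ k, m = s + 1 + k := ⟨m - (s + 1), by omega⟩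
  have h1 : s + 1 + k - 1 - s = k := by omega
  rw [h1]
  have h2 : (1 - ((s + 1 + k : ℕ) : ℤ)) = -(s : ℤ) + -(k : ℤ) := by push_cast; ring
  rw [h2, zpow_add₀ h0, zpow_neg, zpow_neg, zpow_natCast, zpow_natCast, inv_pow, inv_inv, inv_pow]
  field_simp

theorem ratio_lt_one (hy : y ∈ E p m) : ratio p m y < 1 := by
  obtain ⟨s, hs, h⟩ := mem_E_iff.1 hy
  have h1 : (p : ℝ)⁻¹ ^ s ≤ 1 := pow_le_one₀ inv_prime_pos.le inv_prime_lt_one.le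
  have h2 : (p : ℝ)⁻¹ ^ (m - 1 - s) ≤ 1 := pow_le_one₀ inv_prime_pos.le inv_prime_lt_one.le
  have := one_lt_cast_prime (p := p)
  rw [ratio, div_lt_one (by linarith), U_eq hs h]
  linarith

/-- Passing from `d = p⁻ʲ` to `p⁻ʲ⁻¹` in the term `λ_n dⁿ` produces the factor `1 - p⁻ⁿ`. It cancels
the denominator `pⁿ - 1` of `λ_n` and leaves two geometric terms. -/
theorem lambda_mul_one_sub (n : ℕ) :
    lambda p m (n + 1) y * (1 - (p : ℝ)⁻¹ ^ (n + 1)) =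
      lambda0 p / ((p : ℝ) - 1) *
        (p * ratio p m y ^ (n + 1) - (ratio p m y * (p : ℝ)⁻¹) ^ (n + 1)) := by
  have hp := one_lt_cast_prime (p := p)
  have h1 : (p : ℝ) - 1 ≠ 0 := by linarith
  have h2 : (p : ℝ) + 1 ≠ 0 := by linarith
  have h3 : (p : ℝ) ^ (n + 1) - 1 ≠ 0 := by
    have := one_lt_pow₀ hp (Nat.succ_ne_zero n)
    exact (sub_pos.2 this).ne'
  have h0 : (p : ℝ) ≠ 0 := by linarith
  rw [lambda, ratio, mul_pow, div_pow, inv_pow]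
  field_simp
  ring

theorem lambda_nonneg (n : ℕ) : 0 ≤ lambda p m (n + 1) y := by
  have hp := one_lt_cast_prime (p := p)
  have h1 : (0 : ℝ) < (p : ℝ) - 1 := by linarith
  have h3 : (0 : ℝ) < (p : ℝ) ^ (n + 1) - 1 := sub_pos.2 (one_lt_pow₀ hp (Nat.succ_ne_zero n))
  have h4 : (0 : ℝ) < (p : ℝ) ^ (n + 1 + 1) - 1 := sub_pos.2 (one_lt_pow₀ hp (Nat.succ_ne_zero _))
  have h5 : 0 ≤ U p m y := by unfold U; positivity
  have := lambda0_pos (p := p)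
  unfold lambda
  positivity

theorem summable_lambda (hy : y ∈ E p m) : Summable fun n : ℕ => lambda p m (n + 1) y := by
  have hp := one_lt_cast_prime (p := p)
  have h1 : (0 : ℝ) < (p : ℝ) - 1 := by linarith
  have hq : (0 : ℝ) < 1 - (p : ℝ)⁻¹ := sub_pos.2 inv_prime_lt_one
  have hs : Summable fun n : ℕ => (1 - (p : ℝ)⁻¹)⁻¹ *
      (lambda0 p / ((p : ℝ) - 1) * p * ratio p m y * ratio p m y ^ n) :=
    ((summable_geometric_of_lt_one ratio_nonneg (ratio_lt_one hy)).mul_left _).mul_left _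
  refine Summable.of_nonneg_of_le (fun n => lambda_nonneg n) (fun n => ?_) hs
  rw [inv_mul_eq_div, le_div_iff₀ hq]
  have h2 : lambda p m (n + 1) y * (1 - (p : ℝ)⁻¹) ≤
      lambda p m (n + 1) y * (1 - (p : ℝ)⁻¹ ^ (n + 1)) := by
    refine mul_le_mul_of_nonneg_left ?_ (lambda_nonneg n)
    have : (p : ℝ)⁻¹ ^ (n + 1) ≤ (p : ℝ)⁻¹ :=
      pow_le_of_le_one inv_prime_pos.le inv_prime_lt_one.le n.succ_ne_zero
    linarith
  refine h2.trans ?_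
  rw [lambda_mul_one_sub]
  have h3 : 0 ≤ (ratio p m y * (p : ℝ)⁻¹) ^ (n + 1) :=
    pow_nonneg (mul_nonneg ratio_nonneg inv_prime_pos.le) _
  have h4 : 0 ≤ lambda0 p / ((p : ℝ) - 1) := div_nonneg lambda0_pos.le h1.le
  have h5 := mul_nonneg h4 h3
  rw [pow_succ]
  nlinarith

theorem d_nonneg (x y : ℚ_[p]) : 0 ≤ d p x y := by
  unfold d; positivity

theorem d_le_one (x y : ℚ_[p]) : d p x y ≤ 1 :=
  div_le_one_of_le₀ (norm_sub_le_max' x y) (by positivity)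

theorem summable_lambda_mul_pow (hy : y ∈ E p m) {a : ℝ} (h0 : 0 ≤ a) (h1 : a ≤ 1) :
    Summable fun n : ℕ => lambda p m (n + 1) y * a ^ (n + 1) :=
  Summable.of_nonneg_of_le (fun n => mul_nonneg (lambda_nonneg n) (pow_nonneg h0 _))
    (fun n => mul_le_of_le_one_right (lambda_nonneg n) (pow_le_one₀ h0 h1)) (summable_lambda hy)

/-- `d(z, y)` is a function of `|z - y|`. -/
theorem d_eq {s i : ℕ} {z : ℚ_[p]} (hy : ‖y‖ = (p : ℝ)⁻¹ ^ s) (hz : ‖z - y‖ = (p : ℝ)⁻¹ ^ i) :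
    d p z y = (p : ℝ)⁻¹ ^ (i - s) := by
  rw [d]
  -- If `i < s`, then `|z| = |z - y| > |y|` and `d = 1`, which agrees with the truncated subtraction
  -- `i - s = 0`.
  rcases lt_or_ge i s with h | h
  · have h1 : ‖y‖ < ‖z - y‖ := by rw [hy, hz]; exact inv_pow_lt_iff.2 h
    have h2 : ‖z‖ = ‖z - y‖ := by
      have := IsUltrametricDist.norm_add_eq_max_of_norm_ne_norm h1.ne'
      rwa [sub_add_cancel, max_eq_left h1.le] at this
    rw [h2, max_eq_left h1.le, div_self ((norm_nonneg _).trans_lt h1).ne', Nat.sub_eq_zero_of_le h.le,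
      pow_zero]
  · have h1 : ‖z - y‖ ≤ ‖y‖ := by rw [hy, hz]; exact inv_pow_le_iff.2 h
    have h2 : ‖z‖ ≤ ‖y‖ := by
      have := IsUltrametricDist.norm_add_le_max (z - y) y
      rwa [sub_add_cancel, max_eq_right h1] at this
    rw [max_eq_right h2, hy, hz, div_eq_iff (inv_pow_pos s).ne', ← pow_add, Nat.sub_add_cancel h]

theorem logb_inv_pow (k : ℕ) : Real.logb p ((p : ℝ)⁻¹ ^ k) = -(k : ℝ) := by
  rw [inv_pow, Real.logb_inv, Real.logb_pow, Real.logb_self_eq_one one_lt_cast_prime, mul_one]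

/-- The value of `B(x, y)` where `d(x, y) = p⁻ᵏ`. -/
noncomputable def profile (p : ℕ) [Fact p.Prime] (m : ℕ) (y : ℚ_[p]) (k : ℕ) : ℝ :=
  A p m y - lambda0 p * k + ∑' n : ℕ, lambda p m (n + 1) y * ((p : ℝ)⁻¹ ^ k) ^ (n + 1)

theorem B_eq_profile {s i : ℕ} {z : ℚ_[p]} (hy : ‖y‖ = (p : ℝ)⁻¹ ^ s)
    (hz : ‖z - y‖ = (p : ℝ)⁻¹ ^ i) : B p m z y = profile p m y (i - s) := by
  rw [B, d_eq hy hz, logb_inv_pow, profile]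
  ring

/-- This is the purpose of the constant `A`: it makes `B` vanish where `d = 1`, in particular where
`|x| ≠ |y|`. -/
theorem profile_zero : profile p m y 0 = 0 := by
  simp [profile, A]

theorem abs_profile_le (hy : y ∈ E p m) (k : ℕ) :
    |profile p m y k| ≤ lambda0 p * k + |A p m y| := by
  have hq : (p : ℝ)⁻¹ ^ k ≤ 1 := pow_le_one₀ inv_prime_pos.le inv_prime_lt_one.le
  have hs := summable_lambda_mul_pow hy (inv_pow_pos (p := p) k).le hq
  have h0 : 0 ≤ ∑' n : ℕ, lambda p m (n + 1) y * ((p : ℝ)⁻¹ ^ k) ^ (n + 1) :=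
    tsum_nonneg fun n => mul_nonneg (lambda_nonneg n) (pow_nonneg (inv_pow_pos k).le _)
  have h1 : ∑' n : ℕ, lambda p m (n + 1) y * ((p : ℝ)⁻¹ ^ k) ^ (n + 1) ≤ -A p m y := by
    rw [A, neg_neg]
    exact hs.tsum_le_tsum (fun n => mul_le_of_le_one_right (lambda_nonneg n)
      (pow_le_one₀ (inv_pow_pos k).le hq)) (summable_lambda hy)
  have h2 : 0 ≤ lambda0 p * k := mul_nonneg lambda0_pos.le (Nat.cast_nonneg k)
  have h3 := neg_abs_le (A p m y)
  have h4 := abs_nonneg (A p m y)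
  rw [profile, abs_le]
  constructor <;> linarith

/-- The weighted tail sums `∑_{k ≥ j} (g_{k+1} - g_k) p⁻ᵏ` of the increments of the profile `g`. -/
noncomputable def tail (p : ℕ) [Fact p.Prime] (m : ℕ) (y : ℚ_[p]) (j : ℕ) : ℝ :=
  -(lambda0 p * p * (p : ℝ)⁻¹ ^ j / (((p : ℝ) - 1) * (1 - ratio p m y * (p : ℝ)⁻¹ ^ j)))

theorem ratio_mul_lt_one (hy : y ∈ E p m) (j : ℕ) : ratio p m y * (p : ℝ)⁻¹ ^ j < 1 :=
  (mul_le_of_le_one_right ratio_nonneg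
    (pow_le_one₀ inv_prime_pos.le inv_prime_lt_one.le)).trans_lt (ratio_lt_one hy)

/-- The increments of the series are two geometric series, with ratios `a = r p⁻ʲ` and `b = a / p`.
With the increment `-λ₀` of the logarithm they combine into a single product. -/
theorem profile_succ_sub (hy : y ∈ E p m) (j : ℕ) :
    profile p m y (j + 1) - profile p m y j =
      -(lambda0 p / ((1 - ratio p m y * (p : ℝ)⁻¹ ^ j) * (1 - ratio p m y * (p : ℝ)⁻¹ ^ (j + 1)))) := by
  have hp := one_lt_cast_prime (p := p)
  have hp1 : (p : ℝ) - 1 ≠ 0 := by linarith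
  have hp0 : (p : ℝ) ≠ 0 := by linarith
  set r := ratio p m y with hr
  set a := r * (p : ℝ)⁻¹ ^ j with ha
  set b := r * (p : ℝ)⁻¹ ^ (j + 1) with hb
  have hab : b * p = a := by rw [ha, hb, pow_succ]; field_simp
  have ha1 : a < 1 := ratio_mul_lt_one hy j
  have hb1 : b < 1 := ratio_mul_lt_one hy (j + 1)
  have ha0 : 0 ≤ a := mul_nonneg ratio_nonneg (inv_pow_pos j).le
  have hb0 : 0 ≤ b := mul_nonneg ratio_nonneg (inv_pow_pos _).le
  have hle : ∀ k, (p : ℝ)⁻¹ ^ k ≤ 1 := fun k => pow_le_one₀ inv_prime_pos.le inv_prime_lt_one.le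
  have hs := fun k => summable_lambda_mul_pow hy (inv_pow_pos (p := p) k).le (hle k)
  have h1 : HasSum (fun n : ℕ => lambda0 p / ((p : ℝ) - 1) * (p * (a * a ^ n) - b * b ^ n))
      (lambda0 p / ((p : ℝ) - 1) * (p * (a * (1 - a)⁻¹) - b * (1 - b)⁻¹)) :=
    ((((hasSum_geometric_of_lt_one ha0 ha1).mul_left a).mul_left (p : ℝ)).sub
      ((hasSum_geometric_of_lt_one hb0 hb1).mul_left b)).mul_left _
  have h2 : HasSum (fun n : ℕ => lambda p m (n + 1) y * ((p : ℝ)⁻¹ ^ j) ^ (n + 1) -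
      lambda p m (n + 1) y * ((p : ℝ)⁻¹ ^ (j + 1)) ^ (n + 1))
      (lambda0 p / ((p : ℝ) - 1) * (p * (a * (1 - a)⁻¹) - b * (1 - b)⁻¹)) := by
    refine h1.congr_fun fun n => ?_
    have := lambda_mul_one_sub (p := p) (m := m) (y := y) n
    rw [← hr] at this
    have e1 : a * a ^ n = r ^ (n + 1) * ((p : ℝ)⁻¹ ^ j) ^ (n + 1) := by rw [← pow_succ', ha, mul_pow]
    have e2 : b * b ^ n = (r * (p : ℝ)⁻¹) ^ (n + 1) * ((p : ℝ)⁻¹ ^ j) ^ (n + 1) := by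
      rw [← pow_succ', hb, ← mul_pow, pow_succ' _ j, mul_assoc]
    rw [e1, e2]
    have e3 : ((p : ℝ)⁻¹ ^ (j + 1)) ^ (n + 1) =
        (p : ℝ)⁻¹ ^ (n + 1) * ((p : ℝ)⁻¹ ^ j) ^ (n + 1) := by rw [pow_succ' _ j, mul_pow]
    rw [e3]
    linear_combination ((p : ℝ)⁻¹ ^ j) ^ (n + 1) * this
  have h3 := ((hs j).hasSum.sub (hs (j + 1)).hasSum).unique h2
  have ha2 : 1 - a ≠ 0 := by linarith
  have hb2 : 1 - b ≠ 0 := by linarith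
  have h4 : profile p m y (j + 1) - profile p m y j =
      -lambda0 p - lambda0 p / ((p : ℝ) - 1) * (p * (a * (1 - a)⁻¹) - b * (1 - b)⁻¹) := by
    rw [← h3, profile, profile]; push_cast; ring
  rw [h4]
  clear_value a b
  field_simp
  linear_combination lambda0 p * hab

/-- Partial fractions in `p⁻ʲ`. With the limit `0` of `tail`, this is what makes its closed form the
tail sum of the increments. -/
theorem profile_succ_sub_eq_tail (hy : y ∈ E p m) (j : ℕ) :
    (p : ℝ)⁻¹ ^ j * (profile p m y (j + 1) - profile p m y j) =
      tail p m y j - tail p m y (j + 1) := by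
  have hp := one_lt_cast_prime (p := p)
  have hp1 : (p : ℝ) - 1 ≠ 0 := by linarith
  have hp0 : (p : ℝ) ≠ 0 := by linarith
  have h1 : 1 - ratio p m y * (p : ℝ)⁻¹ ^ j ≠ 0 := (sub_pos.2 (ratio_mul_lt_one hy j)).ne'
  have h2 : 1 - ratio p m y * (p : ℝ)⁻¹ ^ (j + 1) ≠ 0 :=
    (sub_pos.2 (ratio_mul_lt_one hy (j + 1))).ne'
  rw [profile_succ_sub hy, tail, tail]
  set a := ratio p m y * (p : ℝ)⁻¹ ^ j with ha
  set b := ratio p m y * (p : ℝ)⁻¹ ^ (j + 1) with hb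
  have hab : b * p = a := by rw [ha, hb, pow_succ]; field_simp
  have h3 : lambda0 p * p * (p : ℝ)⁻¹ ^ (j + 1) = lambda0 p * (p : ℝ)⁻¹ ^ j := by
    rw [pow_succ]; field_simp
  rw [h3]
  generalize (p : ℝ)⁻¹ ^ j = e
  clear_value a b
  field_simp
  linear_combination -(e * lambda0 p) * hab

theorem tendsto_tail : Tendsto (tail p m y) atTop (𝓝 0) := by
  have hq := tendsto_pow_atTop_nhds_zero_of_lt_one inv_prime_pos.le (inv_prime_lt_one (p := p))
  have hp := one_lt_cast_prime (p := p)
  have hp1 : (p : ℝ) - 1 ≠ 0 := by linarith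
  have h := ((hq.const_mul (lambda0 p * p)).div
    (((hq.const_mul (ratio p m y)).const_sub 1).const_mul ((p : ℝ) - 1)) (by simpa using hp1)).neg
  have h0 : -(lambda0 p * p * 0 / (((p : ℝ) - 1) * (1 - ratio p m y * 0))) = 0 := by simp
  rw [h0] at h
  exact h

theorem summable_linear_mul_inv_pow (a b : ℝ) :
    Summable fun i : ℕ => (a * i + b) * (p : ℝ)⁻¹ ^ i := by
  have hq : ‖(p : ℝ)⁻¹‖ < 1 := by
    rw [Real.norm_of_nonneg inv_prime_pos.le]; exact inv_prime_lt_one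
  have h1 := (summable_pow_mul_geometric_of_norm_lt_one 1 hq).mul_left a
  have h2 := (summable_geometric_of_norm_lt_one hq).mul_left b
  refine (h1.add h2).congr fun i => ?_
  rw [pow_one]; ring

theorem summable_abs_profile (hy : y ∈ E p m) (c : ℝ) :
    Summable fun i : ℕ => |profile p m y i - c| * (p : ℝ)⁻¹ ^ i := by
  refine Summable.of_nonneg_of_le (fun i => mul_nonneg (abs_nonneg _) (inv_pow_pos (p := p) i).le)
    (fun i => ?_) (summable_linear_mul_inv_pow (p := p) (lambda0 p) (|A p m y| + |c|))
  refine mul_le_mul_of_nonneg_right ?_ (inv_pow_pos (p := p) i).le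
  have := abs_sub (profile p m y i) c
  have := abs_profile_le hy i
  linarith

theorem hasSum_profile_tail (hy : y ∈ E p m) (j : ℕ) :
    HasSum (fun i : ℕ => (profile p m y (i + j) - profile p m y j) * (p : ℝ)⁻¹ ^ (i + j))
      (tail p m y j / ((p : ℝ) - 1)) := by
  have hp := one_lt_cast_prime (p := p)
  have hp1 : (p : ℝ) - 1 ≠ 0 := by linarith
  have hp0 : (p : ℝ) ≠ 0 := by linarith
  set g := profile p m y with hg
  set c := g j with hc
  have hS := summable_abs_profile hy c
  rw [← hg] at hS
  have hS1 : Summable fun i : ℕ => (g i - c) * (p : ℝ)⁻¹ ^ i := by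
    refine Summable.of_abs (hS.congr fun i => ?_)
    rw [abs_mul, abs_of_pos (inv_pow_pos (p := p) i)]
  -- Abel summation predicts that `Z n` is the sum of `(g i - c) p⁻ⁱ` over `i ≥ n`; its first term
  -- vanishes at `n = j`.
  set Z : ℕ → ℝ := fun i => p / ((p : ℝ) - 1) * ((g i - c) * (p : ℝ)⁻¹ ^ i) +
    tail p m y i / ((p : ℝ) - 1) with hZ
  have hZ0 : Tendsto Z atTop (𝓝 0) := by
    have h := (hS1.tendsto_atTop_zero.const_mul (p / ((p : ℝ) - 1))).add
      ((tendsto_tail (p := p) (m := m) (y := y)).div_const ((p : ℝ) - 1))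
    rw [mul_zero, zero_div, add_zero] at h
    exact h
  have hstep : ∀ i, Z i - Z (i + 1) = (g i - c) * (p : ℝ)⁻¹ ^ i := by
    intro i
    have h := profile_succ_sub_eq_tail hy i
    rw [← hg] at h
    simp only [hZ]
    rw [pow_succ]
    generalize (p : ℝ)⁻¹ ^ i = e at h ⊢
    field_simp
    linear_combination -h
  have hsum : ∀ n, ∑ i ∈ Finset.range n, (g (i + j) - c) * (p : ℝ)⁻¹ ^ (i + j) =
      Z j - Z (n + j) := by
    intro n
    have := Finset.sum_range_sub' (fun i => Z (i + j)) n
    simp only [zero_add] at this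
    rw [← this]
    refine Finset.sum_congr rfl fun i _ => ?_
    rw [← hstep, add_right_comm]
  have hS2 : Summable fun i : ℕ => (g (i + j) - c) * (p : ℝ)⁻¹ ^ (i + j) :=
    (summable_nat_add_iff j).2 hS1
  rw [hS2.hasSum_iff_tendsto_nat]
  simp only [hsum]
  have hlim := ((tendsto_add_atTop_iff_nat j).2 hZ0).const_sub (Z j)
  have : Z j - 0 = tail p m y j / ((p : ℝ) - 1) := by simp [hZ, hc]
  rwa [this] at hlim

end

/-! ### `D` of radial functions and the value of `DB` off the diagonal. -/

section

variable {p : ℕ} [Fact p.Prime] {m : ℕ} {x y : ℚ_[p]}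

theorem exists_norm_sub_eq_inv_pow (hx : ‖x‖ ≤ 1) (hy : ‖y‖ ≤ 1) (hxy : x ≠ y) :
    ∃ l : ℕ, ‖x - y‖ = (p : ℝ)⁻¹ ^ l :=
  exists_norm_eq_inv_pow (sub_ne_zero.2 hxy) (norm_sub_le_one hx hy)

/-- The values of the integrand of `D f(x)` for a radial function `f`. -/
theorem kernelD_radial {f : ℚ_[p] → ℝ} {c : ℕ → ℝ} {l i : ℕ} {z : ℚ_[p]}
    (hf : ∀ z i, ‖z - y‖ = (p : ℝ)⁻¹ ^ i → f z = c i) (hl : ‖x - y‖ = (p : ℝ)⁻¹ ^ l)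
    (hz : ‖z - y‖ = (p : ℝ)⁻¹ ^ i) :
    kernelD p f x z = (c i - c l) / ((p : ℝ)⁻¹ ^ min i l) ^ 2 * ‖x‖ := by
  rw [kernelD, hf z i hz, hf x l hl]
  -- On the sphere `i = l` the distance `|z - x|` is not determined, but there the numerator
  -- vanishes. On the other spheres `|z - x| = max(|z - y|, |x - y|)`.
  rcases eq_or_ne i l with rfl | hil
  · simp
  · have h1 : ‖z - y‖ ≠ ‖y - x‖ := by
      rw [hz, norm_sub_rev, hl]; exact fun h => hil (inv_pow_inj h)
    have h2 := IsUltrametricDist.norm_add_eq_max_of_norm_ne_norm h1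
    rw [sub_add_sub_cancel, norm_sub_rev y x, hz, hl] at h2
    rw [h2]
    congr 3
    rcases le_total i l with h | h
    · rw [min_eq_left h, max_eq_left (inv_pow_le_iff.2 h)]
    · rw [min_eq_right h, max_eq_right (inv_pow_le_iff.2 h)]

theorem summable_kernelD_radial {c : ℕ → ℝ} (l : ℕ)
    (hc : Summable fun i => |c i - c l| * (p : ℝ)⁻¹ ^ i) :
    Summable fun i => |(c i - c l) / ((p : ℝ)⁻¹ ^ min i l) ^ 2 * ‖x‖| * (p : ℝ)⁻¹ ^ i := by
  refine Summable.of_nonneg_of_le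
    (fun i => mul_nonneg (abs_nonneg _) (inv_pow_pos (p := p) i).le) (fun i => ?_)
    (hc.mul_left (‖x‖ / ((p : ℝ)⁻¹ ^ l) ^ 2))
  have h1 := inv_pow_pos (p := p) l
  have h2 : (p : ℝ)⁻¹ ^ l ≤ (p : ℝ)⁻¹ ^ min i l := inv_pow_le_iff.2 (min_le_right i l)
  rw [abs_mul, abs_div, abs_of_nonneg (norm_nonneg x), abs_of_nonneg (sq_nonneg ((p : ℝ)⁻¹ ^ min i l)),
    ← mul_assoc]
  refine mul_le_mul_of_nonneg_right ?_ (inv_pow_pos (p := p) i).le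
  rw [div_mul_eq_mul_div, div_mul_eq_mul_div, mul_comm]
  gcongr

theorem dConverges_of_radial {f : ℚ_[p] → ℝ} {c : ℕ → ℝ} (hx : x ∈ E p m) (hy : y ∈ E p m)
    (hxy : x ≠ y) (hf : ∀ z i, ‖z - y‖ = (p : ℝ)⁻¹ ^ i → f z = c i)
    (hc : ∀ a, Summable fun i => |c i - a| * (p : ℝ)⁻¹ ^ i) : DConverges p m f x := by
  obtain ⟨l, hl⟩ := exists_norm_sub_eq_inv_pow (norm_le_one_of_mem_E hx) (norm_le_one_of_mem_E hy) hxy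
  refine (integrableOn_and_hasSum_of_radial y (fun z i hz => kernelD_radial hf hl hz)
    (summable_kernelD_radial l (hc (c l)))).1.mono_set ?_
  rw [closedBall_one_eq (norm_le_one_of_mem_E hy)]
  exact E_subset_closedBall

/-- The series computes the integral over the whole unit ball, which may be centred at `y`. On the
ball of radius `p⁻ᵐ` about `0` that `E` omits, `|z - y| = |y|` and `|z - x| = |x|`, so the integrand
is the constant `(c s - c l) / |x|`; this is the term added to `D`. -/
theorem D_of_radial {f : ℚ_[p] → ℝ} {c : ℕ → ℝ} {s l : ℕ} (hx : x ∈ E p m) (hs : s < m)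
    (hy : ‖y‖ = (p : ℝ)⁻¹ ^ s) (hl : ‖x - y‖ = (p : ℝ)⁻¹ ^ l)
    (hf : ∀ z i, ‖z - y‖ = (p : ℝ)⁻¹ ^ i → f z = c i)
    (hc : Summable fun i => |c i - c l| * (p : ℝ)⁻¹ ^ i) :
    HasSum (fun i => (c i - c l) / ((p : ℝ)⁻¹ ^ min i l) ^ 2 * ‖x‖ *
      ((p : ℝ)⁻¹ ^ i * (1 - (p : ℝ)⁻¹))) (D p m f x + (c s - c l) / ‖x‖ * (p : ℝ)⁻¹ ^ m) := by
  have hyE : y ∈ E p m := mem_E_iff.2 ⟨s, hs, hy⟩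
  have hx0 : ‖x‖ ≠ 0 := norm_ne_zero_iff.2 (ne_zero_of_mem_E hx)
  obtain ⟨h1, h2⟩ := integrableOn_and_hasSum_of_radial y (fun z i hz => kernelD_radial hf hl hz)
    (summable_kernelD_radial (x := x) l hc)
  rw [closedBall_one_eq (norm_le_one_of_mem_E hyE)] at h1 h2
  have h3 : D p m f x = ∫ z in closedBall 0 1, kernelD p f x z ∂(addHaar p) -
      ∫ z in closedBall 0 ((p : ℝ)⁻¹ ^ m), kernelD p f x z ∂(addHaar p) := by
    rw [D, E_eq_diff]
    exact setIntegral_sdiff isClosed_closedBall.measurableSet h1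
      (closedBall_subset_closedBall (pow_le_one₀ inv_prime_pos.le inv_prime_lt_one.le))
  have h4 : ∫ z in closedBall 0 ((p : ℝ)⁻¹ ^ m), kernelD p f x z ∂(addHaar p) =
      (c s - c l) / ‖x‖ * (p : ℝ)⁻¹ ^ m := by
    have : Set.EqOn (kernelD p f x) (fun _ => (c s - c l) / ‖x‖)
        (closedBall 0 ((p : ℝ)⁻¹ ^ m)) := by
      intro z hz
      rw [mem_closedBall, dist_eq_norm, sub_zero] at hz
      have e1 : ∀ w ∈ E p m, ‖z - w‖ = ‖w‖ := by
        intro w hw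
        have := norm_eq_of_norm_sub_lt (a := w - z) (b := w)
          (by rw [sub_sub_cancel_left, norm_neg]; exact hz.trans_lt (inv_pow_lt_norm_of_mem_E hw))
        rwa [norm_sub_rev] at this
      simp only [kernelD]
      rw [hf z s ((e1 y hyE).trans hy), hf x l hl, e1 x hx]
      field_simp
    rw [setIntegral_congr_fun isClosed_closedBall.measurableSet this, setIntegral_const,
      addHaar_real_closedBall, smul_eq_mul, mul_comm]
  rw [h3, h4, sub_add_cancel]
  exact h2

theorem summable_abs_profile_shift (hy : y ∈ E p m) (s : ℕ) (a : ℝ) :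
    Summable fun i : ℕ => |profile p m y (i - s) - a| * (p : ℝ)⁻¹ ^ i := by
  rw [← summable_nat_add_iff s]
  refine ((summable_abs_profile hy a).mul_right ((p : ℝ)⁻¹ ^ s)).congr fun i => ?_
  rw [Nat.add_sub_cancel, pow_add]; ring

/-- For `|x| = |y|` and `d(x, y) = p⁻ʲ` the left side is `DB(x, y)`: the spheres larger than `|x -
y|`, the omitted ball, and the smaller spheres. The increment formula for the profile is exactly the
condition that it does not change from `j` to `j + 1`. -/
theorem sum_profile_add_tail {s : ℕ} (hs : s < m) (hy : ‖y‖ = (p : ℝ)⁻¹ ^ s) (j : ℕ) :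
    (p : ℝ)⁻¹ ^ s * (1 - (p : ℝ)⁻¹) *
        ∑ i ∈ Finset.range (s + j), (profile p m y (i - s) - profile p m y j) * (p : ℝ) ^ i +
      profile p m y j * (p : ℝ)⁻¹ ^ (m - s) + tail p m y j / p * ((p : ℝ) ^ j) ^ 2 =
    tail p m y 0 / p := by
  have hyE : y ∈ E p m := mem_E_iff.2 ⟨s, hs, hy⟩
  have hp := one_lt_cast_prime (p := p)
  have hp1 : (p : ℝ) - 1 ≠ 0 := by linarith
  have hp2 : (p : ℝ) + 1 ≠ 0 := by linarith
  have hp0 : (p : ℝ) ≠ 0 := by linarith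
  induction j with
  | zero =>
    have : ∑ i ∈ Finset.range (s + 0), (profile p m y (i - s) - profile p m y 0) * (p : ℝ) ^ i = 0 :=
      Finset.sum_eq_zero fun i hi => by
        have : i - s = 0 := by simp at hi; omega
        rw [this, sub_self, zero_mul]
    rw [this, profile_zero]
    simp
  | succ j ih =>
    rw [← ih]
    set g := profile p m y
    -- Moving the base value from `g j` to `g (j + 1)` costs a geometric sum; the new term `i = s +
    -- j` is zero with respect to the old base value.
    have h1 : ∑ i ∈ Finset.range (s + (j + 1)), (g (i - s) - g (j + 1)) * (p : ℝ) ^ i =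
        ∑ i ∈ Finset.range (s + j), (g (i - s) - g j) * (p : ℝ) ^ i -
          (g (j + 1) - g j) * (((p : ℝ) ^ (s + (j + 1)) - 1) / (p - 1)) := by
      rw [← geom_sum_eq (by linarith), ← add_assoc, Finset.sum_range_succ, Finset.sum_range_succ,
        Nat.add_sub_cancel_left, mul_add, Finset.mul_sum, ← sub_sub, ← Finset.sum_sub_distrib]
      rw [sub_eq_add_neg _ ((g (j + 1) - g j) * _)]
      congr 1
      · exact Finset.sum_congr rfl fun i _ => by ring
      · ring
    -- Here `U(y)` arises: its two summands come from the lower end of the geometric sum and from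
    -- the omitted ball.
    have hU : (p : ℝ)⁻¹ ^ s * (p : ℝ)⁻¹ + (p : ℝ)⁻¹ ^ (m - s) =
        ratio p m y * (p + 1) * (p : ℝ)⁻¹ := by
      rw [ratio, div_mul_cancel₀ _ hp2, U_eq hs hy]
      have : m - s = m - 1 - s + 1 := by omega
      rw [this, pow_succ]; ring
    have hδ := profile_succ_sub hyE j
    have ha := ratio_mul_lt_one hyE j
    have hb := ratio_mul_lt_one hyE (j + 1)
    have hT := profile_succ_sub_eq_tail hyE j
    have hT1 : tail p m y (j + 1) = -(lambda0 p * (p : ℝ)⁻¹ ^ j /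
        (((p : ℝ) - 1) * (1 - ratio p m y * (p : ℝ)⁻¹ ^ (j + 1)))) := by
      rw [tail, pow_succ]; field_simp
    rw [h1]
    have key : -(g (j + 1) - g j) * ((p : ℝ) ^ j - (p : ℝ)⁻¹ ^ s * (p : ℝ)⁻¹) +
        (g (j + 1) - g j) * (p : ℝ)⁻¹ ^ (m - s) +
        (tail p m y (j + 1) * p ^ 2 - tail p m y j) / p * ((p : ℝ) ^ j) ^ 2 = 0 := by
      have e1 : tail p m y j = tail p m y (j + 1) + (p : ℝ)⁻¹ ^ j * (g (j + 1) - g j) := by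
        linarith
      have e2 : (g (j + 1) - g j) * ((p : ℝ)⁻¹ ^ s * (p : ℝ)⁻¹ + (p : ℝ)⁻¹ ^ (m - s)) =
        (g (j + 1) - g j) * (ratio p m y * (p + 1) * (p : ℝ)⁻¹) := by rw [hU]
      have e3 : -(g (j + 1) - g j) * (p : ℝ) ^ j + (g (j + 1) - g j) *
          (ratio p m y * (p + 1) * (p : ℝ)⁻¹) +
          (tail p m y (j + 1) * p ^ 2 - tail p m y j) / p * ((p : ℝ) ^ j) ^ 2 = 0 := by
        rw [e1, hδ, hT1]
        have hr : ratio p m y = ratio p m y * (p : ℝ)⁻¹ ^ j * p ^ j := by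
          rw [inv_pow]; field_simp
        have hpj : (p : ℝ) ^ j ≠ 0 := pow_ne_zero _ hp0
        rw [inv_pow _ j] at *
        set b := ratio p m y * (p : ℝ)⁻¹ ^ (j + 1)
        set a := ratio p m y * ((p : ℝ) ^ j)⁻¹
        rw [hr]
        generalize (p : ℝ) ^ j = P at *
        have ha' : 1 - a ≠ 0 := by linarith
        have hb' : 1 - b ≠ 0 := by linarith
        clear_value a b
        field_simp
        ring
      linear_combination e3 + e2
    have hE : (p : ℝ)⁻¹ ^ s * (1 - (p : ℝ)⁻¹) *
        ((g (j + 1) - g j) * (((p : ℝ) ^ (s + (j + 1)) - 1) / (p - 1))) =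
        (g (j + 1) - g j) * ((p : ℝ) ^ j - (p : ℝ)⁻¹ ^ s * (p : ℝ)⁻¹) := by
      rw [inv_pow, pow_add, pow_succ]; field_simp
    rw [mul_sub, hE, pow_succ]
    linear_combination key

/-- `D B(x, y)` off the diagonal, in terms of the valuations. -/
theorem D_B_eq {s t : ℕ} (hs : s < m) (hy : ‖y‖ = (p : ℝ)⁻¹ ^ s) (ht : t < m)
    (hx : ‖x‖ = (p : ℝ)⁻¹ ^ t) (hxy : x ≠ y) :
    D p m (fun z => B p m z y) x = (p : ℝ)⁻¹ ^ (t + s - 2 * min t s) * (tail p m y 0 / p) := by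
  have hyE : y ∈ E p m := mem_E_iff.2 ⟨s, hs, hy⟩
  have hxE : x ∈ E p m := mem_E_iff.2 ⟨t, ht, hx⟩
  have hp := one_lt_cast_prime (p := p)
  have hp1 : (p : ℝ) - 1 ≠ 0 := by linarith
  have hp0 : (p : ℝ) ≠ 0 := by linarith
  obtain ⟨l, hl⟩ := exists_norm_sub_eq_inv_pow (norm_le_one_of_mem_E hxE)
    (norm_le_one_of_mem_E hyE) hxy
  set g := profile p m y with hg
  have hD := D_of_radial (f := fun z => B p m z y) (c := fun i => g (i - s)) hxE hs hy hl
    (fun z i hz => B_eq_profile hy hz) (summable_abs_profile_shift hyE s _)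
  have hq : (1 - (p : ℝ)⁻¹) = (p : ℝ)⁻¹ * (p - 1) := by field_simp
  simp only [Nat.sub_self] at hD
  rw [show g 0 = 0 from profile_zero] at hD
  -- For `t = s` the series splits at the sphere through `x`. For `t ≠ s` one has `d(x, y) = 1`, so
  -- `B(x, y) = 0`, and only the spheres smaller than `|y|` contribute.
  rcases eq_or_ne t s with rfl | hts
  · have hle : t ≤ l := by
      have := norm_sub_le_max' x y
      rw [hl, hx, hy, max_self] at this
      exact inv_pow_le_iff.1 this
    obtain ⟨j, rfl⟩ := Nat.exists_eq_add_of_le hle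
    rw [Nat.add_sub_cancel_left] at hD
    have h1 := (hasSum_nat_add_iff (f := fun i => (g (i - t) - g j) / ((p : ℝ)⁻¹ ^ min i (t + j)) ^ 2 *
      ‖x‖ * ((p : ℝ)⁻¹ ^ i * (1 - (p : ℝ)⁻¹))) (t + j)).1
      (((hasSum_profile_tail hyE j).mul_right
        ((p : ℝ)⁻¹ ^ t * (p : ℝ)⁻¹ ^ t * (1 - (p : ℝ)⁻¹) / ((p : ℝ)⁻¹ ^ (t + j)) ^ 2)).congr_fun
          fun i => ?_)
    · have h2 := hD.unique h1
      have h3 := sum_profile_add_tail hs hy j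
      rw [← hg] at h3
      have h4 : ∑ i ∈ Finset.range (t + j), (g (i - t) - g j) / ((p : ℝ)⁻¹ ^ min i (t + j)) ^ 2 *
          ‖x‖ * ((p : ℝ)⁻¹ ^ i * (1 - (p : ℝ)⁻¹)) = (p : ℝ)⁻¹ ^ t * (1 - (p : ℝ)⁻¹) *
            ∑ i ∈ Finset.range (t + j), (g (i - t) - g j) * (p : ℝ) ^ i := by
        rw [Finset.mul_sum]
        refine Finset.sum_congr rfl fun i hi => ?_
        rw [min_eq_left (Finset.mem_range.1 hi).le, hx, inv_pow _ i]
        field_simp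
      rw [h4, hx] at h2
      have h5 : t + t - 2 * min t t = 0 := by rw [min_self]; omega
      have h6 : (p : ℝ)⁻¹ ^ (m - t) = (p : ℝ)⁻¹ ^ m / (p : ℝ)⁻¹ ^ t := by
        rw [eq_div_iff (inv_pow_pos t).ne', ← pow_add, Nat.sub_add_cancel hs.le]
      have h7 : tail p m y j / ((p : ℝ) - 1) * ((p : ℝ)⁻¹ ^ t * (p : ℝ)⁻¹ ^ t * (1 - (p : ℝ)⁻¹) /
          ((p : ℝ)⁻¹ ^ (t + j)) ^ 2) = tail p m y j / p * ((p : ℝ) ^ j) ^ 2 := by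
        rw [hq, pow_add, inv_pow _ j]; field_simp
      rw [h6] at h3
      rw [h7] at h2
      rw [h5, pow_zero, one_mul]
      linear_combination h2 + h3
    · rw [min_eq_right (Nat.le_add_left _ _), hx]
      have e1 : i + (t + j) - t = i + j := by omega
      rw [e1, show i + (t + j) = (i + j) + t by ring, pow_add _ (i + j) t]
      ring
  · have hlm : l = min t s := by
      have h1 : ‖x‖ ≠ ‖-y‖ := by
        rw [norm_neg, hx, hy]; exact fun h => hts (inv_pow_inj h)
      have h2 := IsUltrametricDist.norm_add_eq_max_of_norm_ne_norm h1
      rw [← sub_eq_add_neg, norm_neg, hl, hx, hy] at h2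
      rcases le_total t s with h | h
      · rw [max_eq_left (inv_pow_le_iff.2 h)] at h2
        rw [min_eq_left h, inv_pow_inj h2]
      · rw [max_eq_right (inv_pow_le_iff.2 h)] at h2
        rw [min_eq_right h, inv_pow_inj h2]
    have hls : l ≤ s := hlm ▸ min_le_right t s
    rw [Nat.sub_eq_zero_of_le hls, show g 0 = 0 from profile_zero, sub_zero, zero_div, zero_mul,
      add_zero] at hD
    have h1 := (hasSum_nat_add_iff (f := fun i => (g (i - s) - 0) / ((p : ℝ)⁻¹ ^ min i l) ^ 2 *
      ‖x‖ * ((p : ℝ)⁻¹ ^ i * (1 - (p : ℝ)⁻¹))) s).1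
      (((hasSum_profile_tail hyE 0).mul_right
        ((p : ℝ)⁻¹ ^ t * (p : ℝ)⁻¹ ^ s * (1 - (p : ℝ)⁻¹) / ((p : ℝ)⁻¹ ^ l) ^ 2)).congr_fun
          fun i => ?_)
    · have h2 := hD.unique h1
      have h4 : ∑ i ∈ Finset.range s, (g (i - s) - 0) / ((p : ℝ)⁻¹ ^ min i l) ^ 2 *
          ‖x‖ * ((p : ℝ)⁻¹ ^ i * (1 - (p : ℝ)⁻¹)) = 0 := by
        refine Finset.sum_eq_zero fun i hi => ?_
        rw [Nat.sub_eq_zero_of_le (Finset.mem_range.1 hi).le, show g 0 = 0 from profile_zero]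
        simp
      rw [h4, add_zero] at h2
      rw [h2, ← hlm]
      have h5 : (p : ℝ)⁻¹ ^ t * (p : ℝ)⁻¹ ^ s =
          (p : ℝ)⁻¹ ^ (t + s - 2 * l) * ((p : ℝ)⁻¹ ^ l) ^ 2 := by
        rw [← pow_add, ← pow_mul, ← pow_add]
        congr 1
        have := min_le_left t s
        omega
      have h6 := inv_pow_pos (p := p) l
      rw [h5, hq]
      field_simp
    · rw [min_eq_right (hls.trans (Nat.le_add_left _ _)), hx, Nat.add_sub_cancel,
        show profile p m y 0 = 0 from profile_zero, pow_add _ i s, Nat.add_zero]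
      ring

theorem tail_zero_div (hy : y ∈ E p m) : tail p m y 0 / p =
    -lambda0 p * (((p : ℝ) + 1) / (((p : ℝ) - 1) * ((p : ℝ) + 1 - U p m y))) := by
  have hp := one_lt_cast_prime (p := p)
  have hp1 : (p : ℝ) - 1 ≠ 0 := by linarith
  have hp2 : (p : ℝ) + 1 ≠ 0 := by linarith
  have hp0 : (p : ℝ) ≠ 0 := by linarith
  have h1 : 1 - ratio p m y ≠ 0 := (sub_pos.2 (ratio_lt_one hy)).ne'
  have h2 : (p : ℝ) + 1 - U p m y = (p + 1) * (1 - ratio p m y) := by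
    rw [ratio]; field_simp
  rw [h2, tail, pow_zero, mul_one, mul_one]
  field_simp

theorem summable_abs_logb_profile (s : ℕ) (a : ℝ) :
    Summable fun i : ℕ => |-((i - s : ℕ) : ℝ) - a| * (p : ℝ)⁻¹ ^ i := by
  refine Summable.of_nonneg_of_le (fun i => mul_nonneg (abs_nonneg _) (inv_pow_pos (p := p) i).le)
    (fun i => ?_) (summable_linear_mul_inv_pow (p := p) 1 |a|)
  refine mul_le_mul_of_nonneg_right ?_ (inv_pow_pos (p := p) i).le
  have h1 := abs_sub (-((i - s : ℕ) : ℝ)) a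
  have h2 : ((i - s : ℕ) : ℝ) ≤ i := by exact_mod_cast Nat.sub_le i s
  rw [abs_neg, Nat.abs_cast] at h1
  linarith

theorem summable_abs_pow_profile (s n : ℕ) (a : ℝ) :
    Summable fun i : ℕ => |((p : ℝ)⁻¹ ^ (i - s)) ^ n - a| * (p : ℝ)⁻¹ ^ i := by
  refine Summable.of_nonneg_of_le (fun i => mul_nonneg (abs_nonneg _) (inv_pow_pos (p := p) i).le)
    (fun i => ?_) (summable_linear_mul_inv_pow (p := p) 0 (1 + |a|))
  refine mul_le_mul_of_nonneg_right ?_ (inv_pow_pos (p := p) i).le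
  have h1 := abs_sub (((p : ℝ)⁻¹ ^ (i - s)) ^ n) a
  have h2 : ((p : ℝ)⁻¹ ^ (i - s)) ^ n ≤ 1 := pow_le_one₀ (inv_pow_pos _).le
    (pow_le_one₀ inv_prime_pos.le inv_prime_lt_one.le)
  rw [abs_of_nonneg (pow_nonneg (inv_pow_pos (p := p) _).le _)] at h1
  linarith

theorem dConverges_B (hx : x ∈ E p m) (hy : y ∈ E p m) (hxy : x ≠ y) :
    DConverges p m (fun z => B p m z y) x := by
  obtain ⟨s, hs, h⟩ := mem_E_iff.1 hy
  exact dConverges_of_radial hx hy hxy (fun z i hz => B_eq_profile h hz)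
    (summable_abs_profile_shift hy s)

theorem dConverges_logb (hx : x ∈ E p m) (hy : y ∈ E p m) (hxy : x ≠ y) :
    DConverges p m (fun z => Real.logb p (d p z y)) x := by
  obtain ⟨s, hs, h⟩ := mem_E_iff.1 hy
  exact dConverges_of_radial hx hy hxy (c := fun i => -((i - s : ℕ) : ℝ))
    (fun z i hz => by rw [d_eq h hz, logb_inv_pow]) (summable_abs_logb_profile s)

theorem dConverges_pow (hx : x ∈ E p m) (hy : y ∈ E p m) (hxy : x ≠ y) (n : ℕ) :
    DConverges p m (fun z => d p z y ^ n) x := by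
  obtain ⟨s, hs, h⟩ := mem_E_iff.1 hy
  exact dConverges_of_radial hx hy hxy (c := fun i => ((p : ℝ)⁻¹ ^ (i - s)) ^ n)
    (fun z i hz => by rw [d_eq h hz]) (summable_abs_pow_profile s n)

theorem norm_sub_eq_of_lt {z : ℚ_[p]} (h : ‖z - x‖ < ‖x - y‖) : ‖z - y‖ = ‖x - y‖ :=
  norm_eq_of_norm_sub_lt (by rwa [sub_sub_sub_cancel_right])

/-- The bound is uniform in `n`, so summability of `λ_n` suffices to exchange sum and integral. For
`|z - x| < |x - y|` the numerator is zero, which removes the singularity at `x`. -/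
theorem abs_kernelD_pow_le (hx : x ∈ E p m) (hy : y ∈ E p m) (hxy : x ≠ y) (n : ℕ) (z : ℚ_[p]) :
    ‖kernelD p (fun z => d p z y ^ n) x z‖ ≤ 1 / ‖x - y‖ ^ 2 := by
  have h0 : 0 < ‖x - y‖ := norm_pos_iff.2 (sub_ne_zero.2 hxy)
  rw [kernelD]
  rcases lt_or_ge ‖z - x‖ ‖x - y‖ with h | h
  · obtain ⟨s, hs, hys⟩ := mem_E_iff.1 hy
    obtain ⟨l, hl⟩ := exists_norm_sub_eq_inv_pow (norm_le_one_of_mem_E hx)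
      (norm_le_one_of_mem_E hy) hxy
    rw [d_eq hys hl, d_eq hys ((norm_sub_eq_of_lt h).trans hl), sub_self, zero_div, zero_mul,
      norm_zero]
    positivity
  · rw [norm_mul, norm_div, norm_norm, norm_pow, norm_norm]
    have h1 : ‖d p z y ^ n - d p x y ^ n‖ ≤ 1 := by
      have a1 : 0 ≤ d p z y ^ n := pow_nonneg (d_nonneg _ _) n
      have a2 : 0 ≤ d p x y ^ n := pow_nonneg (d_nonneg _ _) n
      have a3 : d p z y ^ n ≤ 1 := pow_le_one₀ (d_nonneg _ _) (d_le_one _ _)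
      have a4 : d p x y ^ n ≤ 1 := pow_le_one₀ (d_nonneg _ _) (d_le_one _ _)
      rw [Real.norm_eq_abs, abs_le]; constructor <;> linarith
    refine (mul_le_of_le_one_right (by positivity) (norm_le_one_of_mem_E hx)).trans ?_
    gcongr

/-- `D B(x, y)` is the sum of the terms `λ₀ D log d` and `λₙ D dⁿ`. -/
theorem hasSum_D_B (hx : x ∈ E p m) (hy : y ∈ E p m) (hxy : x ≠ y) :
    HasSum (fun n : ℕ => lambda p m (n + 1) y * D p m (fun z => d p z y ^ (n + 1)) x)
      (D p m (fun z => B p m z y) x - lambda0 p * D p m (fun z => Real.logb p (d p z y)) x) := by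
  have hE : addHaar p (E p m) ≠ ⊤ := (isCompact_E m).measure_lt_top.ne
  have h1 := hasSum_integral_of_summable_integral_norm (μ := (addHaar p).restrict (E p m))
    (F := fun (n : ℕ) z => lambda p m (n + 1) y * kernelD p (fun z => d p z y ^ (n + 1)) x z)
    (fun n => (dConverges_pow hx hy hxy (n + 1)).const_mul _) ?_
  · have h2 : ∀ z, ∑' n : ℕ, lambda p m (n + 1) y * kernelD p (fun z => d p z y ^ (n + 1)) x z =
        kernelD p (fun z => B p m z y) x z -
          lambda0 p * kernelD p (fun z => Real.logb p (d p z y)) x z := by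
      intro z
      have a1 := (summable_lambda_mul_pow hy (d_nonneg z y) (d_le_one z y)).hasSum
      have a2 := (summable_lambda_mul_pow hy (d_nonneg x y) (d_le_one x y)).hasSum
      refine (((a1.sub a2).mul_right (‖x‖ / ‖z - x‖ ^ 2)).congr_fun fun n => ?_).tsum_eq.trans ?_
      · simp only [kernelD]; ring
      · simp only [kernelD, B]; ring
    simp only [h2] at h1
    rw [integral_sub (dConverges_B hx hy hxy) ((dConverges_logb hx hy hxy).const_mul _),
      integral_const_mul] at h1
    simp only [integral_const_mul] at h1
    exact h1
  · refine Summable.of_nonneg_of_le (fun n => integral_nonneg fun z => norm_nonneg _) (fun n => ?_)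
      ((summable_lambda hy).mul_right (1 / ‖x - y‖ ^ 2 * (addHaar p).real (E p m)))
    have h3 := norm_setIntegral_le_of_norm_le_const (μ := addHaar p) (s := E p m)
      (f := fun z => ‖lambda p m (n + 1) y * kernelD p (fun z => d p z y ^ (n + 1)) x z‖)
      (C := lambda p m (n + 1) y * (1 / ‖x - y‖ ^ 2)) hE.lt_top (fun z _ => by
        rw [norm_norm, norm_mul, Real.norm_of_nonneg (lambda_nonneg n)]
        exact mul_le_mul_of_nonneg_left (abs_kernelD_pow_le hx hy hxy _ z) (lambda_nonneg n))
    rw [← mul_assoc]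
    exact (Real.le_norm_self _).trans h3

end

/-! ### Pairings with `Dφ` as finite sums over balls; Dirichlet energy. -/

section

variable {p : ℕ} [Fact p.Prime] {m N : ℕ} {T : Finset ℚ_[p]} {x y : ℚ_[p]}

theorem closedBall_subset_E (hN : m ≤ N) (hx : x ∈ E p m) :
    closedBall x ((p : ℝ)⁻¹ ^ N) ⊆ E p m := by
  intro z hz
  rw [mem_closedBall, dist_eq_norm] at hz
  have h := norm_eq_of_norm_sub_lt
    ((hz.trans (inv_pow_le_iff.2 hN)).trans_lt (inv_pow_lt_norm_of_mem_E hx))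
  rw [mem_E_iff] at hx ⊢
  rwa [h]

/-- `T` is a system of representatives of the balls of radius `p⁻ᴺ` in `E`. -/
structure IsBallReps (p : ℕ) [Fact p.Prime] (m N : ℕ) (T : Finset ℚ_[p]) : Prop where
  le : m ≤ N
  mem : ∀ t ∈ T, t ∈ E p m
  exists_close : ∀ x ∈ E p m, ∃ t ∈ T, ‖x - t‖ ≤ (p : ℝ)⁻¹ ^ N
  eq_of_close : ∀ t ∈ T, ∀ u ∈ T, ‖t - u‖ ≤ (p : ℝ)⁻¹ ^ N → t = u

theorem exists_isBallReps (hN : m ≤ N) : ∃ T, IsBallReps p m N T := by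
  set β : ℚ_[p] → Set ℚ_[p] := fun x => closedBall x ((p : ℝ)⁻¹ ^ N)
  have hβ : ∀ {x z : ℚ_[p]}, ‖x - z‖ ≤ (p : ℝ)⁻¹ ^ N → β z = β x := fun h =>
    IsUltrametricDist.closedBall_eq_of_mem (by rwa [mem_closedBall, dist_eq_norm])
  obtain ⟨T₀, -, hf, hc⟩ := (isCompact_E (p := p) m).finite_cover_balls (inv_pow_pos (p := p) N)
  have hfin : (β '' E p m).Finite := by
    refine (hf.image β).subset ?_
    rintro _ ⟨x, hx, rfl⟩
    obtain ⟨t, ht, hxt⟩ := Set.mem_iUnion₂.1 (hc hx)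
    exact ⟨t, ht, hβ (by rw [mem_ball, dist_eq_norm] at hxt; exact hxt.le)⟩
  obtain ⟨T, hTE, hT⟩ := Set.SurjOn.exists_bijOn_subset (Set.surjOn_image β (E p m))
  have hTf : T.Finite := Set.Finite.of_finite_image (hT.image_eq ▸ hfin) hT.injOn
  refine ⟨hTf.toFinset, hN, fun t ht => hTE (by simpa using ht), fun x hx => ?_,
    fun t ht u hu h => hT.injOn (by simpa using ht) (by simpa using hu) (hβ h).symm⟩
  obtain ⟨t, ht, h⟩ := hT.surjOn (Set.mem_image_of_mem β hx)
  refine ⟨t, by simpa using ht, ?_⟩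
  have : x ∈ β t := by rw [h]; exact mem_closedBall_self (inv_pow_pos N).le
  rwa [mem_closedBall, dist_eq_norm] at this

namespace IsBallReps

theorem E_eq (hT : IsBallReps p m N T) : E p m = ⋃ t ∈ T, closedBall t ((p : ℝ)⁻¹ ^ N) := by
  ext x
  simp only [Set.mem_iUnion, mem_closedBall, dist_eq_norm, exists_prop]
  refine ⟨hT.exists_close x, fun ⟨t, ht, h⟩ => closedBall_subset_E hT.le (hT.mem t ht) ?_⟩
  rwa [mem_closedBall, dist_eq_norm]

theorem pairwiseDisjoint (hT : IsBallReps p m N T) :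
    (T : Set ℚ_[p]).Pairwise (Function.onFun Disjoint fun t => closedBall t ((p : ℝ)⁻¹ ^ N)) := by
  intro t ht u hu htu
  refine Set.disjoint_left.2 fun z h1 h2 => htu (hT.eq_of_close t ht u hu ?_)
  rw [mem_closedBall, dist_eq_norm] at h1 h2
  have := norm_sub_le_max' (z - u) (z - t)
  rw [sub_sub_sub_cancel_left] at this
  exact this.trans (max_le h2 h1)

theorem integrableOn_E (hT : IsBallReps p m N T) {f : ℚ_[p] → ℝ}
    (hf : ∀ t ∈ T, IntegrableOn f (closedBall t ((p : ℝ)⁻¹ ^ N)) (addHaar p)) :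
    IntegrableOn f (E p m) (addHaar p) := by
  rw [hT.E_eq]
  exact integrableOn_finset_iUnion.2 hf

theorem setIntegral_E (hT : IsBallReps p m N T) {f : ℚ_[p] → ℝ}
    (hf : ∀ t ∈ T, IntegrableOn f (closedBall t ((p : ℝ)⁻¹ ^ N)) (addHaar p)) :
    ∫ x in E p m, f x ∂(addHaar p) =
      ∑ t ∈ T, ∫ x in closedBall t ((p : ℝ)⁻¹ ^ N), f x ∂(addHaar p) := by
  rw [hT.E_eq]
  exact integral_biUnion_finset T (fun t _ => isClosed_closedBall.measurableSet)
    hT.pairwiseDisjoint hf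

end IsBallReps

/-- The function `f` is constant on each ball of radius `p⁻ᴺ` in `E`. -/
def ConstOnBalls (p : ℕ) [Fact p.Prime] (m N : ℕ) (f : ℚ_[p] → ℝ) : Prop :=
  ∀ x ∈ E p m, ∀ z, ‖z - x‖ ≤ (p : ℝ)⁻¹ ^ N → f z = f x

theorem integrableOn_closedBall_of_const {f : ℚ_[p] → ℝ}
    (hf : ∀ z, ‖z - x‖ ≤ (p : ℝ)⁻¹ ^ N → f z = f x) :
    IntegrableOn f (closedBall x ((p : ℝ)⁻¹ ^ N)) (addHaar p) :=
  (integrableOn_const (C := f x) (addHaar_closedBall_lt_top _ _).ne).congr_fun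
    (fun z hz => (hf z (by rwa [mem_closedBall, dist_eq_norm] at hz)).symm)
    isClosed_closedBall.measurableSet

theorem setIntegral_closedBall_of_const {f : ℚ_[p] → ℝ}
    (hf : ∀ z, ‖z - x‖ ≤ (p : ℝ)⁻¹ ^ N → f z = f x) :
    ∫ z in closedBall x ((p : ℝ)⁻¹ ^ N), f z ∂(addHaar p) = (p : ℝ)⁻¹ ^ N * f x := by
  rw [setIntegral_congr_fun (g := fun _ => f x) isClosed_closedBall.measurableSet
    (fun z hz => hf z (by rwa [mem_closedBall, dist_eq_norm] at hz)), setIntegral_const,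
    addHaar_real_closedBall, smul_eq_mul]

/-- The kernel `1 / |x - u|²`, truncated to distances greater than `p⁻ᴺ`. -/
noncomputable def weight (p : ℕ) [Fact p.Prime] (N : ℕ) (x u : ℚ_[p]) : ℝ :=
  if ‖x - u‖ ≤ (p : ℝ)⁻¹ ^ N then 0 else (‖x - u‖ ^ 2)⁻¹

theorem weight_symm (x u : ℚ_[p]) : weight p N x u = weight p N u x := by
  rw [weight, weight, norm_sub_rev]

theorem weight_nonneg (x u : ℚ_[p]) : 0 ≤ weight p N x u := by
  unfold weight; split_ifs <;> positivity

theorem norm_sub_eq_of_close {z u : ℚ_[p]} (hz : ‖z - u‖ ≤ (p : ℝ)⁻¹ ^ N)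
    (h : (p : ℝ)⁻¹ ^ N < ‖u - x‖) : ‖z - x‖ = ‖u - x‖ :=
  norm_eq_of_norm_sub_lt (by rw [sub_sub_sub_cancel_right]; exact hz.trans_lt h)

theorem weight_congr {z u : ℚ_[p]} (hz : ‖z - u‖ ≤ (p : ℝ)⁻¹ ^ N) :
    weight p N z x = weight p N u x := by
  unfold weight
  by_cases h : ‖u - x‖ ≤ (p : ℝ)⁻¹ ^ N
  · have h1 := IsUltrametricDist.norm_add_le_max (z - u) (u - x)
    rw [sub_add_sub_cancel] at h1
    rw [if_pos h, if_pos (h1.trans (max_le hz h))]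
  · rw [norm_sub_eq_of_close hz (not_le.1 h)]

/-- The truncation loses nothing, because the numerator vanishes on the ball around `x`; elsewhere
`|z - x|` is constant on each ball. -/
theorem kernelD_eq_weight {f : ℚ_[p] → ℝ} {z u : ℚ_[p]}
    (hf : ∀ z, ‖z - x‖ ≤ (p : ℝ)⁻¹ ^ N → f z = f x) (hz : ‖z - u‖ ≤ (p : ℝ)⁻¹ ^ N) :
    kernelD p f x z = ‖x‖ * weight p N x u * (f z - f x) := by
  rw [weight_symm, ← weight_congr hz, weight, kernelD]
  split_ifs with h
  · rw [hf z h]; simp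
  · ring

namespace IsBallReps

/-- Constancy is required only on the ball around `x`, so that the formula also applies to a
function with a singularity elsewhere. -/
theorem D_eq_sum (hT : IsBallReps p m N T) {f : ℚ_[p] → ℝ}
    (hf : ∀ z, ‖z - x‖ ≤ (p : ℝ)⁻¹ ^ N → f z = f x) (hi : IntegrableOn f (E p m) (addHaar p)) :
    D p m f x = ‖x‖ * ∑ u ∈ T, weight p N x u *
      (∫ z in closedBall u ((p : ℝ)⁻¹ ^ N), f z ∂(addHaar p) - (p : ℝ)⁻¹ ^ N * f x) := by
  have hE : ∀ u ∈ T, Set.EqOn (kernelD p f x) (fun z => ‖x‖ * weight p N x u * (f z - f x))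
      (closedBall u ((p : ℝ)⁻¹ ^ N)) := fun u _ z hz =>
    kernelD_eq_weight hf (by rwa [mem_closedBall, dist_eq_norm] at hz)
  have hfi : ∀ u ∈ T, IntegrableOn f (closedBall u ((p : ℝ)⁻¹ ^ N)) (addHaar p) := fun u hu =>
    hi.mono_set (closedBall_subset_E hT.le (hT.mem u hu))
  have hci : ∀ u : ℚ_[p], IntegrableOn (fun _ => f x) (closedBall u ((p : ℝ)⁻¹ ^ N)) (addHaar p) :=
    fun u => integrableOn_const (addHaar_closedBall_lt_top _ _).ne
  rw [D, hT.setIntegral_E, Finset.mul_sum]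
  · refine Finset.sum_congr rfl fun u hu => ?_
    rw [setIntegral_congr_fun isClosed_closedBall.measurableSet (hE u hu), integral_const_mul,
      integral_sub (hfi u hu) (hci u), setIntegral_const, addHaar_real_closedBall, smul_eq_mul,
      mul_assoc]
  · exact fun u hu => IntegrableOn.congr_fun (((hfi u hu).sub (hci u)).const_mul _)
      (hE u hu).symm isClosed_closedBall.measurableSet

theorem integrableOn_of_const (hT : IsBallReps p m N T) {f : ℚ_[p] → ℝ}
    (hf : ConstOnBalls p m N f) : IntegrableOn f (E p m) (addHaar p) :=
  hT.integrableOn_E fun t ht => integrableOn_closedBall_of_const (hf t (hT.mem t ht))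

theorem setIntegral_mulHaar_of_const (hT : IsBallReps p m N T) {f : ℚ_[p] → ℝ}
    (hf : ConstOnBalls p m N f) :
    ∫ x in E p m, f x ∂(mulHaar p) = ∑ t ∈ T, (p : ℝ)⁻¹ ^ N * (‖t‖⁻¹ * f t) := by
  have h : ConstOnBalls p m N fun x => ‖x‖⁻¹ * f x := by
    intro x hx z hz
    simp only
    rw [hf x hx z hz, norm_eq_of_norm_sub_lt
      ((hz.trans (inv_pow_le_iff.2 hT.le)).trans_lt (inv_pow_lt_norm_of_mem_E hx))]
  rw [setIntegral_mulHaar,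
    hT.setIntegral_E fun t ht => integrableOn_closedBall_of_const (h t (hT.mem t ht))]
  exact Finset.sum_congr rfl fun t ht => setIntegral_closedBall_of_const (h t (hT.mem t ht))

/-- The pairing of `D φ` with an integrable function as a finite sum. -/
theorem setIntegral_mul_D (hT : IsBallReps p m N T) {H φ : ℚ_[p] → ℝ}
    (hH : IntegrableOn H (E p m) (addHaar p)) (hφ : ConstOnBalls p m N φ) :
    ∫ x in E p m, H x * D p m φ x ∂(mulHaar p) = (p : ℝ)⁻¹ ^ N * ∑ t ∈ T, ∑ u ∈ T, weight p N t u *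
      ((∫ z in closedBall t ((p : ℝ)⁻¹ ^ N), H z ∂(addHaar p)) * (φ u - φ t)) := by
  set κ : ℚ_[p] → ℝ := fun t => ∑ u ∈ T, weight p N t u * ((p : ℝ)⁻¹ ^ N * (φ u - φ t)) with hκ
  have hD : ∀ x ∈ E p m, D p m φ x = ‖x‖ * κ x := by
    intro x hx
    rw [hT.D_eq_sum (hφ x hx) (hT.integrableOn_of_const hφ), hκ]
    congr 1
    refine Finset.sum_congr rfl fun u hu => ?_
    rw [setIntegral_closedBall_of_const (hφ u (hT.mem u hu))]
    ring
  have hE : ∀ t ∈ T, Set.EqOn (fun x => ‖x‖⁻¹ * (H x * D p m φ x)) (fun x => H x * κ t)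
      (closedBall t ((p : ℝ)⁻¹ ^ N)) := by
    intro t ht x hxt
    have hx := closedBall_subset_E hT.le (hT.mem t ht) hxt
    rw [mem_closedBall, dist_eq_norm] at hxt
    have h1 : κ x = κ t := by
      simp only [hκ]
      exact Finset.sum_congr rfl fun u _ => by
        rw [weight_congr hxt, hφ t (hT.mem t ht) x hxt]
    have hx0 : ‖x‖ ≠ 0 := norm_ne_zero_iff.2 (ne_zero_of_mem_E hx)
    simp only
    rw [hD x hx, h1]
    field_simp
  have hi : ∀ t ∈ T, IntegrableOn (fun x => H x * κ t) (closedBall t ((p : ℝ)⁻¹ ^ N)) (addHaar p) :=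
    fun t ht => (hH.mono_set (closedBall_subset_E hT.le (hT.mem t ht))).mul_const _
  rw [setIntegral_mulHaar, hT.setIntegral_E fun t ht =>
    (hi t ht).congr_fun (hE t ht).symm isClosed_closedBall.measurableSet, Finset.mul_sum]
  refine Finset.sum_congr rfl fun t ht => ?_
  rw [setIntegral_congr_fun isClosed_closedBall.measurableSet (hE t ht), integral_mul_const, hκ,
    Finset.mul_sum, Finset.mul_sum]
  exact Finset.sum_congr rfl fun u _ => by ring

end IsBallReps

/-- Self-adjointness of a graph Laplacian. -/
theorem sum_sum_symm {ι : Type*} (S : Finset ι) {w : ι → ι → ℝ} (hw : ∀ t u, w t u = w u t)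
    (a b : ι → ℝ) : ∑ t ∈ S, ∑ u ∈ S, w t u * (a t * (b u - b t)) =
      ∑ t ∈ S, ∑ u ∈ S, w t u * (b t * (a u - a t)) := by
  have h : ∑ t ∈ S, ∑ u ∈ S, w t u * (a t * b u) = ∑ t ∈ S, ∑ u ∈ S, w t u * (b t * a u) := by
    rw [Finset.sum_comm]
    exact Finset.sum_congr rfl fun t _ => Finset.sum_congr rfl fun u _ => by rw [hw u t]; ring
  simp only [mul_sub, Finset.sum_sub_distrib]
  rw [h]
  congr 1
  exact Finset.sum_congr rfl fun t _ => Finset.sum_congr rfl fun u _ => by ring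

theorem sum_sum_sq {ι : Type*} (S : Finset ι) {w : ι → ι → ℝ} (hw : ∀ t u, w t u = w u t)
    (a : ι → ℝ) : ∑ t ∈ S, ∑ u ∈ S, w t u * (a u - a t) ^ 2 =
      -2 * ∑ t ∈ S, ∑ u ∈ S, w t u * (a t * (a u - a t)) := by
  have h : ∑ t ∈ S, ∑ u ∈ S, w t u * (a u * (a t - a u)) =
      ∑ t ∈ S, ∑ u ∈ S, w t u * (a t * (a u - a t)) := by
    rw [Finset.sum_comm]
    exact Finset.sum_congr rfl fun t _ => Finset.sum_congr rfl fun u _ => by rw [hw u t]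
  have h2 : ∑ t ∈ S, ∑ u ∈ S, w t u * (a u - a t) ^ 2 =
      -(∑ t ∈ S, ∑ u ∈ S, w t u * (a t * (a u - a t))) -
        ∑ t ∈ S, ∑ u ∈ S, w t u * (a u * (a t - a u)) := by
    rw [← Finset.sum_neg_distrib, ← Finset.sum_sub_distrib]
    refine Finset.sum_congr rfl fun t _ => ?_
    rw [← Finset.sum_neg_distrib, ← Finset.sum_sub_distrib]
    exact Finset.sum_congr rfl fun u _ => by ring
  rw [h2, h]; ring

/-- A function whose weighted Dirichlet energy vanishes is constant. -/
theorem eq_of_sum_sum_eq_zero {ι : Type*} (S : Finset ι) {w : ι → ι → ℝ}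
    (hw : ∀ t u, w t u = w u t) (h0 : ∀ t u, 0 ≤ w t u)
    (hpos : ∀ t ∈ S, ∀ u ∈ S, t ≠ u → w t u ≠ 0) {a : ι → ℝ}
    (ha : ∑ t ∈ S, ∑ u ∈ S, w t u * (a t * (a u - a t)) = 0) {t u : ι} (ht : t ∈ S) (hu : u ∈ S) :
    a t = a u := by
  have h1 := sum_sum_sq S hw a
  rw [ha, mul_zero, Finset.sum_eq_zero_iff_of_nonneg fun t _ => Finset.sum_nonneg fun u _ =>
    mul_nonneg (h0 t u) (sq_nonneg _)] at h1
  have h2 := h1 t ht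
  rw [Finset.sum_eq_zero_iff_of_nonneg fun u _ => mul_nonneg (h0 t u) (sq_nonneg _)] at h2
  have h3 := h2 u hu
  by_contra hne
  rcases mul_eq_zero.1 h3 with h | h
  · exact hpos t ht u hu (fun h => hne (h ▸ rfl)) h
  · exact hne (sub_eq_zero.1 (pow_eq_zero_iff two_ne_zero |>.1 h)).symm

theorem IsBallReps.weight_ne_zero (hT : IsBallReps p m N T) {t u : ℚ_[p]} (ht : t ∈ T) (hu : u ∈ T)
    (h : t ≠ u) : weight p N t u ≠ 0 := by
  rw [weight, if_neg fun h' => h (hT.eq_of_close t ht u hu h')]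
  exact inv_ne_zero (pow_ne_zero _ (norm_ne_zero_iff.2 (sub_ne_zero.2 h)))

theorem exists_constOnBalls {φ : ℚ_[p] → ℝ} (hφ : IsLocallyConstant φ) :
    ∃ N, m ≤ N ∧ ConstOnBalls p m N φ := by
  obtain ⟨δ, hδ, h⟩ := lebesgue_number_lemma_of_metric (c := fun r : ℝ => φ ⁻¹' {r})
    (isCompact_E (p := p) m) (fun r => hφ.isOpen_fiber r) fun x _ => Set.mem_iUnion.2 ⟨φ x, rfl⟩
  obtain ⟨n, hn⟩ := exists_pow_lt_of_lt_one hδ (inv_prime_lt_one (p := p))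
  refine ⟨max m n, le_max_left _ _, fun x hx z hz => ?_⟩
  obtain ⟨r, hr⟩ := h x hx
  have h1 : φ x = r := hr (mem_ball_self hδ)
  have h2 : φ z = r := hr (by
    rw [mem_ball, dist_eq_norm]
    exact (hz.trans (inv_pow_le_iff.2 (le_max_right m n))).trans_lt hn)
  rw [h1, h2]

/-- Pairing `D φ` with a function that is locally constant off `y` and on which `D` is constant
off `y`. -/
theorem setIntegral_mul_D_of_locallyConstant {H φ : ℚ_[p] → ℝ} {κ : ℝ} (hy : y ∈ E p m)
    (hH : IntegrableOn H (E p m) (addHaar p))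
    (hloc : ∀ x ∈ E p m, ∀ z, ‖z - x‖ < ‖x - y‖ → ‖z - x‖ ≤ (p : ℝ)⁻¹ ^ m → H z = H x)
    (hD : ∀ x ∈ E p m, x ≠ y → D p m H x = κ) (hφ : IsLocallyConstant φ) :
    ∫ x in E p m, H x * D p m φ x ∂(mulHaar p) =
      κ * (∫ x in E p m, φ x ∂(mulHaar p) - (mulHaar p).real (E p m) * φ y) := by
  obtain ⟨N, hN, hc⟩ := exists_constOnBalls (m := m) hφ
  obtain ⟨T, hT⟩ := exists_isBallReps (p := p) hN
  set Γ : ℚ_[p] → ℝ := fun t => ∫ z in closedBall t ((p : ℝ)⁻¹ ^ N), H z ∂(addHaar p) with hΓ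
  have hV : (mulHaar p).real (E p m) = ∑ t ∈ T, (p : ℝ)⁻¹ ^ N * (‖t‖⁻¹ * 1) := by
    rw [← hT.setIntegral_mulHaar_of_const (f := fun _ => 1) (fun x _ z _ => rfl)]
    simp
  -- The factor `φ t - φ y` vanishes on the ball containing `y`, the only one on which `H` need not
  -- be constant.
  have key : ∀ t ∈ T, (φ t - φ y) * ∑ u ∈ T, weight p N t u * (Γ u - Γ t) =
      (φ t - φ y) * (κ * ‖t‖⁻¹) := by
    intro t ht
    have htE := hT.mem t ht
    by_cases hty : ‖t - y‖ ≤ (p : ℝ)⁻¹ ^ N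
    · rw [hc y hy t hty, sub_self, zero_mul, zero_mul]
    · have hne : t ≠ y := by
        rintro rfl; exact hty (by simp)
      have hcon : ∀ z, ‖z - t‖ ≤ (p : ℝ)⁻¹ ^ N → H z = H t := fun z hz =>
        hloc t htE z (hz.trans_lt (not_le.1 hty)) (hz.trans (inv_pow_le_iff.2 hN))
      have h1 := hT.D_eq_sum hcon hH
      rw [hD t htE hne, ← setIntegral_closedBall_of_const hcon] at h1
      have ht0 : ‖t‖ ≠ 0 := norm_ne_zero_iff.2 (ne_zero_of_mem_E htE)
      rw [h1, mul_comm ‖t‖, mul_inv_cancel_right₀ ht0]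
  rw [hT.setIntegral_mul_D hH hc]
  have h2 : ∀ t ∈ T, ∀ u ∈ T, weight p N t u * (Γ t * (φ u - φ t)) =
      weight p N t u * (Γ t * ((φ u - φ y) - (φ t - φ y))) := fun t _ u _ => by ring
  rw [Finset.sum_congr rfl fun t ht => Finset.sum_congr rfl (h2 t ht),
    sum_sum_symm T weight_symm Γ (fun t => φ t - φ y), hT.setIntegral_mulHaar_of_const hc, hV,
    Finset.sum_mul, ← Finset.sum_sub_distrib, Finset.mul_sum, Finset.mul_sum]
  refine Finset.sum_congr rfl fun t ht => ?_
  have h3 := key t ht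
  rw [Finset.mul_sum] at h3
  have h4 : ∑ u ∈ T, weight p N t u * ((φ t - φ y) * (Γ u - Γ t)) =
      ∑ u ∈ T, (φ t - φ y) * (weight p N t u * (Γ u - Γ t)) :=
    Finset.sum_congr rfl fun u _ => by ring
  rw [h4, h3]
  ring

/-- Two functions that agree as functionals on the image of `D` have the same ball integrals up to
a constant. -/
theorem setIntegral_sub_eq {H₁ H₂ : ℚ_[p] → ℝ} (h₁ : IntegrableOn H₁ (E p m) (addHaar p))
    (h₂ : IntegrableOn H₂ (E p m) (addHaar p))
    (h : ∀ φ : ℚ_[p] → ℝ, IsLocallyConstant φ →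
      ∫ x in E p m, H₁ x * D p m φ x ∂(mulHaar p) = ∫ x in E p m, H₂ x * D p m φ x ∂(mulHaar p))
    (hN : m ≤ N) {a b : ℚ_[p]} (ha : a ∈ E p m) (hb : b ∈ E p m) :
    ∫ z in closedBall a ((p : ℝ)⁻¹ ^ N), (H₁ z - H₂ z) ∂(addHaar p) =
      ∫ z in closedBall b ((p : ℝ)⁻¹ ^ N), (H₁ z - H₂ z) ∂(addHaar p) := by
  obtain ⟨T, hT⟩ := exists_isBallReps (p := p) hN
  -- With the ball integrals of `H₁ - H₂` as test function, the hypothesis says that their Dirichlet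
  -- energy is zero.
  set φ : ℚ_[p] → ℝ := fun x =>
    ∫ z in closedBall x ((p : ℝ)⁻¹ ^ N), (H₁ z - H₂ z) ∂(addHaar p) with hφ
  have hconst : ∀ x z : ℚ_[p], ‖z - x‖ ≤ (p : ℝ)⁻¹ ^ N → φ z = φ x := by
    intro x z hz
    simp only [hφ]
    rw [IsUltrametricDist.closedBall_eq_of_mem (x := x) (y := z)
      (by rwa [mem_closedBall, dist_eq_norm])]
  have hloc : IsLocallyConstant φ := by
    rw [IsLocallyConstant.iff_eventually_eq]
    intro x
    filter_upwards [closedBall_mem_nhds x (inv_pow_pos (p := p) N)] with z hz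
    exact hconst x z (by rwa [mem_closedBall, dist_eq_norm] at hz)
  have hc : ConstOnBalls p m N φ := fun x _ z hz => hconst x z hz
  have h3 := h φ hloc
  rw [hT.setIntegral_mul_D h₁ hc, hT.setIntegral_mul_D h₂ hc] at h3
  have h4 := mul_left_cancel₀ (inv_pow_pos N).ne' h3
  have h5 : ∑ t ∈ T, ∑ u ∈ T, weight p N t u * (φ t * (φ u - φ t)) = 0 := by
    rw [← sub_eq_zero, ← Finset.sum_sub_distrib] at h4
    rw [← h4]
    refine Finset.sum_congr rfl fun t ht => ?_
    rw [← Finset.sum_sub_distrib]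
    refine Finset.sum_congr rfl fun u _ => ?_
    have hs := closedBall_subset_E hT.le (hT.mem t ht)
    have : φ t = _ := integral_sub (h₁.mono_set hs) (h₂.mono_set hs)
    rw [← mul_sub, ← sub_mul, ← this]
  obtain ⟨t, ht, hat⟩ := hT.exists_close a ha
  obtain ⟨u, hu, hbu⟩ := hT.exists_close b hb
  change φ a = φ b
  rw [hconst t a hat, hconst u b hbu]
  exact eq_of_sum_sum_eq_zero T weight_symm weight_nonneg
    (fun t ht u hu => hT.weight_ne_zero ht hu) h5 ht hu

theorem tendsto_average {H : ℚ_[p] → ℝ} {a : ℚ_[p]} (hi : IntegrableOn H (E p m) (addHaar p))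
    (ha : a ∈ E p m) (hH : ContinuousAt H a) :
    Tendsto (fun N : ℕ => (∫ z in closedBall a ((p : ℝ)⁻¹ ^ N), H z ∂(addHaar p)) / (p : ℝ)⁻¹ ^ N)
      atTop (𝓝 (H a)) := by
  rw [Metric.tendsto_atTop]
  intro δ hδ
  obtain ⟨r, hr, h⟩ := Metric.continuousAt_iff.1 hH (δ / 2) (by positivity)
  obtain ⟨n, hn⟩ := exists_pow_lt_of_lt_one hr (inv_prime_lt_one (p := p))
  refine ⟨max m n, fun N hN => ?_⟩
  have hq := inv_pow_pos (p := p) N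
  have hI := hi.mono_set (closedBall_subset_E ((le_max_left m n).trans hN) ha)
  have hc : IntegrableOn (fun _ => H a) (closedBall a ((p : ℝ)⁻¹ ^ N)) (addHaar p) :=
    integrableOn_const (addHaar_closedBall_lt_top _ _).ne
  have h1 := norm_setIntegral_le_of_norm_le_const (μ := addHaar p)
    (s := closedBall a ((p : ℝ)⁻¹ ^ N)) (f := fun z => H z - H a) (C := δ / 2)
    (addHaar_closedBall_lt_top _ _) (fun z hz => by
      have := h ((mem_closedBall.1 hz).trans_lt
        ((inv_pow_le_iff.2 ((le_max_right m n).trans hN)).trans_lt hn))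
      rw [Real.dist_eq] at this
      exact this.le)
  rw [integral_sub hI hc, setIntegral_const, addHaar_real_closedBall, smul_eq_mul,
    Real.norm_eq_abs] at h1
  rw [Real.dist_eq]
  have h2 : (∫ z in closedBall a ((p : ℝ)⁻¹ ^ N), H z ∂(addHaar p)) / (p : ℝ)⁻¹ ^ N - H a =
      ((∫ z in closedBall a ((p : ℝ)⁻¹ ^ N), H z ∂(addHaar p)) - (p : ℝ)⁻¹ ^ N * H a) /
        (p : ℝ)⁻¹ ^ N := by
    rw [sub_div, mul_div_cancel_left₀ _ hq.ne']
  rw [h2, abs_div, abs_of_pos hq, div_lt_iff₀ hq]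
  nlinarith

theorem isOpen_E (m : ℕ) : IsOpen (E p m) := by
  rw [Metric.isOpen_iff]
  intro x hx
  exact ⟨_, inv_pow_pos (p := p) m, ball_subset_closedBall.trans (closedBall_subset_E le_rfl hx)⟩

/-- Functions on `E`, continuous off `y`, that agree as functionals on the image of `D` differ by
a constant off `y`. -/
theorem sub_eq_sub_of_forall_setIntegral_eq {H₁ H₂ : ℚ_[p] → ℝ}
    (h₁ : IntegrableOn H₁ (E p m) (addHaar p)) (h₂ : IntegrableOn H₂ (E p m) (addHaar p))
    (c₁ : ContinuousOn H₁ {x | x ∈ E p m ∧ x ≠ y}) (c₂ : ContinuousOn H₂ {x | x ∈ E p m ∧ x ≠ y})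
    (h : ∀ φ : ℚ_[p] → ℝ, IsLocallyConstant φ →
      ∫ x in E p m, H₁ x * D p m φ x ∂(mulHaar p) = ∫ x in E p m, H₂ x * D p m φ x ∂(mulHaar p))
    {a b : ℚ_[p]} (ha : a ∈ E p m) (hay : a ≠ y) (hb : b ∈ E p m) (hby : b ≠ y) :
    H₁ a - H₂ a = H₁ b - H₂ b := by
  have ho : IsOpen {x | x ∈ E p m ∧ x ≠ y} := (isOpen_E m).inter isOpen_ne
  have hc : ∀ x ∈ E p m, x ≠ y → ContinuousAt (fun x => H₁ x - H₂ x) x := fun x hx hxy =>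
    (c₁.continuousAt (ho.mem_nhds ⟨hx, hxy⟩)).sub (c₂.continuousAt (ho.mem_nhds ⟨hx, hxy⟩))
  refine tendsto_nhds_unique (tendsto_average (h₁.sub h₂) ha (hc a ha hay))
    ((tendsto_average (h₁.sub h₂) hb (hc b hb hby)).congr' ?_)
  filter_upwards [eventually_ge_atTop m] with N hN
  simp only [Pi.sub_apply]
  rw [setIntegral_sub_eq h₁ h₂ h hN ha hb]

end

/-! ### The Laplacian on valuations; existence and uniqueness of Green's functions. -/

section

/-- A weighted graph Laplacian on a finite set has a symmetric Green's matrix. -/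
theorem exists_green_matrix {ι : Type*} [Fintype ι] [Nonempty ι] [DecidableEq ι] {w : ι → ι → ℝ}
    (hw : ∀ t u, w t u = w u t) (h0 : ∀ t u, 0 ≤ w t u) (hpos : ∀ t u, t ≠ u → w t u ≠ 0) :
    ∃ N : ι → ι → ℝ, (∀ s t, N s t = N t s) ∧
      ∀ t s, ∑ u, w t u * (N u s - N t s) = (if t = s then 1 else 0) - 1 / Fintype.card ι := by
  -- The all-ones matrix minus the Laplacian: the constants are no longer in the kernel. Each column
  -- of the inverse sums to `1 / card`, so `-M⁻¹` has the required Laplacian.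
  set M : Matrix ι ι ℝ := Matrix.of fun t u => 1 - (w t u - if t = u then ∑ v, w t v else 0) with hM
  have hmul : ∀ (a : ι → ℝ) t, ∑ u, M t u * a u = ∑ u, a u - ∑ u, w t u * (a u - a t) := by
    intro a t
    simp only [hM, Matrix.of_apply, sub_mul, one_mul, mul_sub, ite_mul, zero_mul, Finset.sum_sub_distrib,
      Finset.sum_ite_eq, Finset.mem_univ, if_true, Finset.sum_mul]
  have hzero : ∀ a : ι → ℝ, ∑ t, ∑ u, w t u * (a u - a t) = 0 := by
    intro a
    have := sum_sum_symm Finset.univ hw (fun _ => 1) a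
    simpa using this
  have hinj : Function.Injective M.mulVec := by
    refine (injective_iff_map_eq_zero (Matrix.mulVecLin M)).2 fun a ha => ?_
    have h1 : ∀ t, ∑ u, a u - ∑ u, w t u * (a u - a t) = 0 := fun t => by
      rw [← hmul]; exact congrFun ha t
    have h2 : ∑ t, a t = 0 := by
      have h3 : ∑ t, (∑ u, a u - ∑ u, w t u * (a u - a t)) = 0 :=
        Finset.sum_eq_zero fun t _ => h1 t
      rw [Finset.sum_sub_distrib, hzero, sub_zero, Finset.sum_const, nsmul_eq_mul] at h3
      refine (mul_eq_zero.1 h3).resolve_left ?_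
      exact_mod_cast Finset.card_ne_zero.2 Finset.univ_nonempty
    have h4 : ∑ t, ∑ u, w t u * (a t * (a u - a t)) = 0 := by
      refine Finset.sum_eq_zero fun t _ => ?_
      have h5 := h1 t
      rw [h2, zero_sub, neg_eq_zero] at h5
      rw [← mul_zero (a t), ← h5, Finset.mul_sum]
      exact Finset.sum_congr rfl fun u _ => by ring
    have h6 := fun t u => eq_of_sum_sum_eq_zero Finset.univ hw h0
      (fun t _ u _ => hpos t u) h4 (Finset.mem_univ t) (Finset.mem_univ u)
    funext t
    have h7 : ∑ u, a u = Fintype.card ι * a t := by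
      rw [Finset.sum_congr rfl fun u _ => h6 u t, Finset.sum_const, nsmul_eq_mul, Finset.card_univ]
    rw [h2] at h7
    exact (mul_eq_zero.1 h7.symm).resolve_left (by exact_mod_cast Fintype.card_ne_zero)
  have hunit : IsUnit M := Matrix.mulVec_injective_iff_isUnit.1 hinj
  have hsymm : M.transpose = M := by
    ext t u
    simp only [Matrix.transpose_apply, hM, Matrix.of_apply]
    rcases eq_or_ne t u with rfl | h
    · rfl
    · rw [if_neg h, if_neg h.symm, hw]
  have hinv : M * M⁻¹ = 1 := Matrix.mul_nonsing_inv M ((Matrix.isUnit_iff_isUnit_det M).1 hunit)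
  have hinvs : ∀ s t, M⁻¹ s t = M⁻¹ t s := by
    intro s t
    have := Matrix.transpose_nonsing_inv M
    rw [hsymm] at this
    exact congrFun (congrFun this t) s
  have h1 : ∀ t s, ∑ u, M⁻¹ u s - ∑ u, w t u * (M⁻¹ u s - M⁻¹ t s) = if t = s then 1 else 0 := by
    intro t s
    rw [← hmul fun u => M⁻¹ u s, ← Matrix.one_apply, ← hinv, Matrix.mul_apply]
  have h2 : ∀ s, ∑ u, M⁻¹ u s = 1 / Fintype.card ι := by
    intro s
    have h3 : ∑ t, (∑ u, M⁻¹ u s - ∑ u, w t u * (M⁻¹ u s - M⁻¹ t s)) = 1 := by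
      simp only [h1, Finset.sum_ite_eq', Finset.mem_univ, if_true]
    rw [Finset.sum_sub_distrib, hzero fun u => M⁻¹ u s, sub_zero, Finset.sum_const, nsmul_eq_mul,
      Finset.card_univ] at h3
    rw [eq_div_iff (by exact_mod_cast Fintype.card_ne_zero), mul_comm, h3]
  refine ⟨fun s t => -M⁻¹ s t, fun s t => congrArg Neg.neg (hinvs s t), fun t s => ?_⟩
  have h3 := h1 t s
  rw [h2] at h3
  have h4 : ∑ u, w t u * (-M⁻¹ u s - -M⁻¹ t s) = -∑ u, w t u * (M⁻¹ u s - M⁻¹ t s) := by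
    rw [← Finset.sum_neg_distrib]
    exact Finset.sum_congr rfl fun u _ => by ring
  rw [h4, ← h3]
  ring

/-- The weight between the spheres of radii `p⁻ᵗ` and `p⁻ᵘ`. -/
noncomputable def shellWeight (p t u : ℕ) : ℝ :=
  (p : ℝ)⁻¹ ^ (t + u - 2 * min t u) * (1 - (p : ℝ)⁻¹)

theorem shellWeight_symm (p t u : ℕ) : shellWeight p t u = shellWeight p u t := by
  rw [shellWeight, shellWeight, add_comm, min_comm]

variable {p : ℕ} [Fact p.Prime] {m : ℕ} {x y : ℚ_[p]}

theorem shellWeight_pos (t u : ℕ) : 0 < shellWeight p t u :=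
  mul_pos (inv_pow_pos _) (sub_pos.2 inv_prime_lt_one)

theorem setIntegral_E_of_shell {f : ℚ_[p] → ℝ} {F : ℕ → ℝ}
    (hf : ∀ z, ∀ t < m, ‖z‖ = (p : ℝ)⁻¹ ^ t → f z = F t) :
    IntegrableOn f (E p m) (addHaar p) ∧
      ∫ z in E p m, f z ∂(addHaar p) =
        ∑ t ∈ Finset.range m, F t * ((p : ℝ)⁻¹ ^ t * (1 - (p : ℝ)⁻¹)) := by
  obtain ⟨h1, h2⟩ := integrableOn_and_hasSum_of_radial (0 : ℚ_[p]) (f := (E p m).indicator f)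
    (c := fun t => if t < m then F t else 0) (fun z t hz => by
      rw [sub_zero] at hz
      split_ifs with ht
      · rw [Set.indicator_of_mem (mem_E_iff.2 ⟨t, ht, hz⟩), hf z t ht hz]
      · refine Set.indicator_of_notMem (fun h => ht ?_) f
        obtain ⟨s, hs, hzs⟩ := mem_E_iff.1 h
        rwa [inv_pow_inj (hz.symm.trans hzs)])
    (summable_of_ne_finset_zero (L := .unconditional ℕ) (s := Finset.range m) fun t ht => by
      rw [if_neg (by simpa using ht), abs_zero, zero_mul])
  rw [setIntegral_indicator (measurableSet_E m), Set.inter_eq_right.2 E_subset_closedBall] at h2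
  constructor
  · exact (h1.mono_set E_subset_closedBall).congr_fun
      (fun z hz => Set.indicator_of_mem hz f) (measurableSet_E m)
  · refine h2.unique ?_
    have h3 := hasSum_sum_of_ne_finset_zero (L := .unconditional ℕ) (s := Finset.range m)
      (f := fun t => (if t < m then F t else 0) * ((p : ℝ)⁻¹ ^ t * (1 - (p : ℝ)⁻¹)))
      (fun t ht => by rw [if_neg (by simpa using ht), zero_mul])
    rwa [Finset.sum_congr rfl fun t ht => by rw [if_pos (Finset.mem_range.1 ht)]] at h3

/-- `D` of a function of the norm. -/
theorem D_of_shell {f : ℚ_[p] → ℝ} {F : ℕ → ℝ}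
    (hf : ∀ z, ∀ t < m, ‖z‖ = (p : ℝ)⁻¹ ^ t → f z = F t) {t : ℕ} (ht : t < m)
    (hx : ‖x‖ = (p : ℝ)⁻¹ ^ t) :
    DConverges p m f x ∧
      D p m f x = ∑ u ∈ Finset.range m, shellWeight p t u * (F u - F t) := by
  obtain ⟨h1, h2⟩ := setIntegral_E_of_shell (m := m) (f := kernelD p f x)
    (F := fun u => (F u - F t) / ((p : ℝ)⁻¹ ^ min u t) ^ 2 * (p : ℝ)⁻¹ ^ t) (fun z u hu hz => by
      rw [kernelD, hf z u hu hz, hf x t ht hx, hx]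
      rcases eq_or_ne u t with rfl | hut
      · simp
      · have h1 : ‖z‖ ≠ ‖-x‖ := by
          rw [norm_neg, hz, hx]; exact fun h => hut (inv_pow_inj h)
        have h2 := IsUltrametricDist.norm_add_eq_max_of_norm_ne_norm h1
        rw [← sub_eq_add_neg, norm_neg, hz, hx] at h2
        rw [h2]
        congr 3
        rcases le_total u t with h | h
        · rw [min_eq_left h, max_eq_left (inv_pow_le_iff.2 h)]
        · rw [min_eq_right h, max_eq_right (inv_pow_le_iff.2 h)])
  refine ⟨h1, h2.trans (Finset.sum_congr rfl fun u _ => ?_)⟩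
  have h5 : (p : ℝ)⁻¹ ^ t * (p : ℝ)⁻¹ ^ u =
      (p : ℝ)⁻¹ ^ (t + u - 2 * min t u) * ((p : ℝ)⁻¹ ^ min u t) ^ 2 := by
    rw [← pow_add, ← pow_mul, ← pow_add, min_comm u t]
    congr 1
    have := min_le_left t u
    have := min_le_right t u
    omega
  have h6 : ((p : ℝ)⁻¹ ^ min u t) ^ 2 ≠ 0 := pow_ne_zero _ (inv_pow_pos (p := p) _).ne'
  rw [shellWeight, div_mul_eq_mul_div, div_mul_eq_mul_div, div_eq_iff h6]
  linear_combination (F u - F t) * (1 - (p : ℝ)⁻¹) * h5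

theorem mulHaar_real_E : (mulHaar p).real (E p m) = m * (1 - (p : ℝ)⁻¹) := by
  have h1 : (mulHaar p).real (E p m) = ∫ x in E p m, (1 : ℝ) ∂(mulHaar p) := by simp
  rw [h1, setIntegral_mulHaar, (setIntegral_E_of_shell (m := m) (f := fun x : ℚ_[p] => ‖x‖⁻¹ * 1)
    (F := fun t => ((p : ℝ)⁻¹ ^ t)⁻¹) (fun z t _ hz => by rw [hz, mul_one])).2]
  rw [Finset.sum_congr rfl fun t _ => inv_mul_cancel_left₀ (inv_pow_pos (p := p) t).ne' _, Finset.sum_const,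
    Finset.card_range, nsmul_eq_mul]

/-- Two geometric series, below and above the valuation `s`. This identifies the denominator of
`DB(x, y)` as a row sum of the graph. -/
theorem sum_shellWeight {s : ℕ} (hs : s < m) (hy : ‖y‖ = (p : ℝ)⁻¹ ^ s) :
    ∑ u ∈ Finset.range m, shellWeight p s u = ((p : ℝ) + 1 - U p m y) / p := by
  have hp0 : (p : ℝ) ≠ 0 := cast_prime_pos.ne'
  obtain ⟨k, rfl⟩ : ∃ k, m = s + (k + 1) := ⟨m - s - 1, by omega⟩
  have h1 : ∑ u ∈ Finset.range s, shellWeight p s u =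
      (p : ℝ)⁻¹ * (∑ i ∈ Finset.range s, (p : ℝ)⁻¹ ^ i) * (1 - (p : ℝ)⁻¹) := by
    rw [← Finset.sum_range_reflect, Finset.mul_sum, Finset.sum_mul]
    refine Finset.sum_congr rfl fun i hi => ?_
    have hi' := Finset.mem_range.1 hi
    rw [shellWeight, min_eq_right (by omega),
      show s + (s - 1 - i) - 2 * (s - 1 - i) = i + 1 by omega, pow_succ']
  have h2 : ∑ i ∈ Finset.range (k + 1), shellWeight p s (s + i) =
      (∑ i ∈ Finset.range (k + 1), (p : ℝ)⁻¹ ^ i) * (1 - (p : ℝ)⁻¹) := by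
    rw [Finset.sum_mul]
    refine Finset.sum_congr rfl fun i _ => ?_
    rw [shellWeight, min_eq_left (Nat.le_add_right _ _), show s + (s + i) - 2 * s = i by omega]
  have hg : ∀ n, (∑ i ∈ Finset.range n, (p : ℝ)⁻¹ ^ i) * (1 - (p : ℝ)⁻¹) = 1 - (p : ℝ)⁻¹ ^ n :=
    fun n => geom_sum_mul_neg _ n
  rw [Finset.sum_range_add, h1, h2, mul_assoc, hg, hg, U_eq hs hy,
    show s + (k + 1) - 1 - s = k by omega, pow_succ]
  field_simp
  ring

/-- A symmetric function of two valuations whose Laplacian is prescribed so as to correct `B` to a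
Green's function. -/
theorem exists_shell_correction (p : ℕ) [Fact p.Prime] (hm : 1 ≤ m) :
    ∃ c : ℕ → ℕ → ℝ, (∀ s t, c s t = c t s) ∧
    ∀ t < m, ∀ s < m, ∑ u ∈ Finset.range m, shellWeight p t u * (c u s - c t s) =
      (1 - (p : ℝ)⁻¹)⁻¹ * (shellWeight p t s / ∑ u ∈ Finset.range m, shellWeight p s u - 1 / m) := by
  classical
  have : Nonempty (Fin m) := ⟨⟨0, hm⟩⟩
  obtain ⟨N, hN, hN2⟩ := exists_green_matrix (ι := Fin m) (w := fun t u => shellWeight p t u)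
    (fun t u => shellWeight_symm _ _ _) (fun t u => (shellWeight_pos _ _).le)
    (fun t u _ => (shellWeight_pos _ _).ne')
  set h : ℕ → ℝ := fun s => ∑ u ∈ Finset.range m, shellWeight p s u with hh
  have hpos : ∀ s, h s ≠ 0 := fun s =>
    (Finset.sum_pos (fun u _ => shellWeight_pos s u) ⟨0, Finset.mem_range.2 hm⟩).ne'
  -- The Laplacian of the diagonal term `(h s)⁻¹` is `shellWeight p t s / h s` minus the identity
  -- matrix; the Green's matrix `N` turns that identity into `1 / m`.
  set c : ℕ → ℕ → ℝ := fun s t => (1 - (p : ℝ)⁻¹)⁻¹ *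
    ((if hst : s < m ∧ t < m then N ⟨s, hst.1⟩ ⟨t, hst.2⟩ else 0) + if s = t then (h t)⁻¹ else 0)
    with hc
  refine ⟨c, fun s t => ?_, fun t ht s hs => ?_⟩
  · simp only [hc]
    congr 2
    · by_cases hst : s < m ∧ t < m
      · rw [dif_pos hst, dif_pos hst.symm, hN]
      · rw [dif_neg hst, dif_neg fun h => hst h.symm]
    · rcases eq_or_ne s t with rfl | hst
      · rfl
      · rw [if_neg hst, if_neg hst.symm]
  · have h1 := hN2 ⟨t, ht⟩ ⟨s, hs⟩
    have h2 : ∀ u : Fin m, shellWeight p t u * (c u s - c t s) = (1 - (p : ℝ)⁻¹)⁻¹ *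
        (shellWeight p t u * (N u ⟨s, hs⟩ - N ⟨t, ht⟩ ⟨s, hs⟩) +
          ((if u = ⟨s, hs⟩ then shellWeight p t s * (h s)⁻¹ else 0) -
            shellWeight p t u * if t = s then (h s)⁻¹ else 0)) := by
      intro u
      simp only [hc]
      rw [dif_pos ⟨u.2, hs⟩, dif_pos ⟨ht, hs⟩]
      rcases eq_or_ne u ⟨s, hs⟩ with rfl | hu
      · simp only [if_true]; ring
      · have : (u : ℕ) ≠ s := fun h => hu (Fin.ext h)
        rw [if_neg hu, if_neg this]; ring
    rw [← Fin.sum_univ_eq_sum_range (fun u => shellWeight p t u * (c u s - c t s)),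
      Finset.sum_congr rfl fun u _ => h2 u, ← Finset.mul_sum, Finset.sum_add_distrib,
      Finset.sum_sub_distrib, h1, Finset.sum_ite_eq', if_pos (Finset.mem_univ _),
      ← Finset.sum_mul, Fin.sum_univ_eq_sum_range (fun u => shellWeight p t u), Fintype.card_fin]
    congr 1
    simp only [Fin.mk.injEq]
    rw [div_eq_mul_inv]
    rcases eq_or_ne t s with rfl | hts
    · rw [if_pos rfl, if_pos rfl]
      have : (∑ u ∈ Finset.range m, shellWeight p t u) * (h t)⁻¹ = 1 := mul_inv_cancel₀ (hpos t)
      rw [this]; simp only [hh]; ring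
    · rw [if_neg hts, if_neg hts]; simp only [hh]; ring

/-- The exponent `t` of a real number `p⁻ᵗ`. -/
noncomputable def level (p : ℕ) (a : ℝ) : ℕ := ⌊-Real.logb p a⌋₊

theorem level_inv_pow (t : ℕ) : level p ((p : ℝ)⁻¹ ^ t) = t := by
  rw [level, logb_inv_pow, neg_neg, Nat.floor_natCast]

theorem B_congr {x' y' : ℚ_[p]} (hx : ‖x'‖ = ‖x‖) (hy : ‖y'‖ = ‖y‖) (h : ‖x' - y'‖ = ‖x - y‖) :
    B p m x' y' = B p m x y := by
  simp only [B, A, lambda, U, d, hx, hy, h]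

theorem B_eq_zero_of_norm_ne (h : ‖x‖ ≠ ‖y‖) : B p m x y = 0 := by
  have h2 := IsUltrametricDist.norm_add_eq_max_of_norm_ne_norm (x := x) (y := -y)
    (by rwa [norm_neg])
  rw [← sub_eq_add_neg, norm_neg] at h2
  have h3 : max ‖x‖ ‖y‖ ≠ 0 := by
    intro h0
    have h1 := (le_max_left _ _).trans h0.le
    have h2 := (le_max_right _ _).trans h0.le
    exact h ((le_antisymm h1 (norm_nonneg _)).trans (le_antisymm h2 (norm_nonneg _)).symm)
  have h1 : d p x y = 1 := by rw [d, h2, div_self h3]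
  rw [B, h1]
  simp [A]

/-- The coefficients involve `y` only through `|y|`, so the asymmetry could matter only for `|x| ≠
|y|`, where `B` vanishes. -/
theorem B_symm (x y : ℚ_[p]) : B p m x y = B p m y x := by
  by_cases h : ‖x‖ = ‖y‖
  · exact B_congr h h.symm (norm_sub_rev x y)
  · rw [B_eq_zero_of_norm_ne h, B_eq_zero_of_norm_ne (Ne.symm h)]

theorem integrableOn_B (hy : y ∈ E p m) :
    IntegrableOn (fun x => B p m x y) (E p m) (addHaar p) := by
  obtain ⟨s, hs, h⟩ := mem_E_iff.1 hy
  refine (integrableOn_and_hasSum_of_radial y (fun z i hz => B_eq_profile h hz) ?_).1.mono_set ?_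
  · simpa using summable_abs_profile_shift hy s 0
  · rw [closedBall_one_eq (norm_le_one_of_mem_E hy)]
    exact E_subset_closedBall

theorem kernelD_add (f g : ℚ_[p] → ℝ) (x : ℚ_[p]) :
    kernelD p (fun z => f z + g z) x = fun z => kernelD p f x z + kernelD p g x z := by
  funext z
  simp only [kernelD]; ring

/-- At a point of `E × E` off the diagonal `|x|`, `|y|` and `|x - y|` are nonzero, hence locally
constant, and so is `G`. -/
theorem continuousOn_of_norm_congr {G : ℚ_[p] → ℚ_[p] → ℝ}
    (hG : ∀ x y x' y' : ℚ_[p], ‖x'‖ = ‖x‖ → ‖y'‖ = ‖y‖ → ‖x' - y'‖ = ‖x - y‖ → G x' y' = G x y) :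
    ContinuousOn (fun w : ℚ_[p] × ℚ_[p] => G w.1 w.2)
      {w | w.1 ∈ E p m ∧ w.2 ∈ E p m ∧ w.1 ≠ w.2} := by
  rintro ⟨x, y⟩ ⟨hx, hy, hxy⟩
  have hev : ∀ f : ℚ_[p] × ℚ_[p] → ℚ_[p], Continuous f → f (x, y) ≠ 0 →
      ∀ᶠ w in 𝓝 (x, y), ‖f w‖ = ‖f (x, y)‖ := by
    intro f hf h0
    have h1 : Tendsto (fun w => ‖f w - f (x, y)‖) (𝓝 (x, y)) (𝓝 0) := by
      have : Continuous fun w => ‖f w - f (x, y)‖ := by fun_prop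
      simpa using this.tendsto (x, y)
    filter_upwards [h1.eventually_lt_const (norm_pos_iff.2 h0)] with w hw
    exact norm_eq_of_norm_sub_lt hw
  refine ContinuousAt.continuousWithinAt ((continuousAt_const (y := G x y)).congr ?_)
  filter_upwards [hev Prod.fst continuous_fst (ne_zero_of_mem_E hx),
    hev Prod.snd continuous_snd (ne_zero_of_mem_E hy),
    hev (fun w => w.1 - w.2) (by fun_prop) (sub_ne_zero.2 hxy)] with w h1 h2 h3
  exact (hG _ _ _ _ h1 h2 h3).symm

theorem exists_isGreen (p : ℕ) [Fact p.Prime] (hm : 1 ≤ m) :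
    ∃ C : ℝ → ℝ → ℝ, IsGreen p m fun x y => B p m x y + C ‖x‖ ‖y‖ := by
  obtain ⟨c, hsymm, hc⟩ := exists_shell_correction p hm
  set C : ℝ → ℝ → ℝ := fun a b => c (level p a) (level p b) with hC
  have hq : (0 : ℝ) < 1 - (p : ℝ)⁻¹ := sub_pos.2 inv_prime_lt_one
  have hV : (0 : ℝ) < (mulHaar p).real (E p m) := by
    rw [mulHaar_real_E]
    exact mul_pos (by exact_mod_cast hm) hq
  obtain ⟨T, hT⟩ := exists_isBallReps (p := p) (le_refl m)
  have hint : ∀ y ∈ E p m,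
      IntegrableOn (fun x => B p m x y + C ‖x‖ ‖y‖) (E p m) (addHaar p) := fun y hy =>
    (integrableOn_B hy).add (hT.integrableOn_of_const fun x hx z hz => by
      rw [norm_eq_of_norm_sub_lt (hz.trans_lt (inv_pow_lt_norm_of_mem_E hx))])
  have hD : ∀ y ∈ E p m, ∀ x ∈ E p m, x ≠ y →
      D p m (fun x => B p m x y + C ‖x‖ ‖y‖) x = -(1 / (mulHaar p).real (E p m)) := by
    intro y hy x hx hxy
    obtain ⟨s, hs, hys⟩ := mem_E_iff.1 hy
    obtain ⟨t, ht, hxt⟩ := mem_E_iff.1 hx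
    obtain ⟨h1, h2⟩ := D_of_shell (m := m) (f := fun z : ℚ_[p] => C ‖z‖ ‖y‖) (F := fun u => c u s)
      (fun z u _ hz => by simp only [hC]; rw [hz, hys, level_inv_pow, level_inv_pow]) ht hxt
    rw [hc t ht s hs] at h2
    have h3 : D p m (fun x => B p m x y + C ‖x‖ ‖y‖) x =
        D p m (fun x => B p m x y) x + D p m (fun x => C ‖x‖ ‖y‖) x := by
      rw [D, kernelD_add]
      exact integral_add (dConverges_B hx hy hxy) h1
    -- `DB` is `-p^{-|t-s|}` divided by the row sum at `s`. The correction cancels it and leaves `-1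
    -- / (m (1 - p⁻¹)) = -1 / V`.
    rw [h3, h2, D_B_eq hs hys ht hxt hxy, tail_zero_div hy, sum_shellWeight hs hys, mulHaar_real_E,
      shellWeight]
    have hp := one_lt_cast_prime (p := p)
    have hU : (p : ℝ) + 1 - U p m y ≠ 0 := by
      have h := ratio_lt_one hy
      rw [ratio, div_lt_one (by linarith)] at h
      linarith
    have hp0 : (p : ℝ) ≠ 0 := by linarith
    have hp1 : (p : ℝ) - 1 ≠ 0 := by linarith
    have hp2 : (p : ℝ) + 1 ≠ 0 := by linarith
    have hm0 : (m : ℝ) ≠ 0 := by exact_mod_cast (Nat.one_le_iff_ne_zero.1 hm)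
    have hq' : 1 - (p : ℝ)⁻¹ = (p - 1) / p := by field_simp
    rw [hq', lambda0]
    generalize (p : ℝ)⁻¹ ^ (t + s - 2 * min t s) = a
    field_simp
    ring
  refine ⟨C, fun x _ y _ => ?_, continuousOn_of_norm_congr
      (G := fun x y => B p m x y + C ‖x‖ ‖y‖) fun x y x' y' hx hy h => ?_,
    fun y hy => integrableOn_mulHaar_iff.2 (hint y hy), fun y hy φ hφ => ?_⟩
  · simp only [hC]
    rw [B_symm, hsymm]
  · rw [B_congr hx hy h, hx, hy]
  · rw [setIntegral_mul_D_of_locallyConstant hy (hint y hy) (fun x hx z hz hzm => ?_) (hD y hy) hφ]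
    · field_simp
      ring
    · have h1 := norm_eq_of_norm_sub_lt (hzm.trans_lt (inv_pow_lt_norm_of_mem_E hx))
      rw [B_congr h1 rfl (norm_sub_eq_of_lt hz), h1]

theorem infinite_E (hm : 1 ≤ m) : (E p m).Infinite := by
  have h1 : (1 : ℚ_[p]) ∈ E p m := mem_E_iff.2 ⟨0, hm, by simp⟩
  exact infinite_of_mem_nhds 1 ((isOpen_E m).mem_nhds h1)

/-- Two symmetric Green's functions differ by a constant off the diagonal. -/
theorem IsGreen.exists_eq_add_const {G G' : ℚ_[p] → ℚ_[p] → ℝ} (hm : 1 ≤ m) (hG : IsGreen p m G)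
    (hG' : IsGreen p m G') :
    ∃ k : ℝ, ∀ x ∈ E p m, ∀ y ∈ E p m, x ≠ y → G x y = G' x y + k := by
  have hcont : ∀ {H : ℚ_[p] → ℚ_[p] → ℝ}, IsGreen p m H → ∀ y ∈ E p m,
      ContinuousOn (fun x => H x y) {x | x ∈ E p m ∧ x ≠ y} := fun hH y hy =>
    hH.continuousOn.comp (f := fun x => (x, y)) (by fun_prop) fun x hx => ⟨hx.1, hy, hx.2⟩
  have key : ∀ y ∈ E p m, ∀ a ∈ E p m, ∀ b ∈ E p m, a ≠ y → b ≠ y →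
      G a y - G' a y = G b y - G' b y := fun y hy a ha b hb hay hby =>
    sub_eq_sub_of_forall_setIntegral_eq (integrableOn_mulHaar_iff.1 (hG.integrableOn y hy))
      (integrableOn_mulHaar_iff.1 (hG'.integrableOn y hy)) (hcont hG y hy) (hcont hG' y hy)
      (fun φ hφ => (hG.green y hy φ hφ).trans (hG'.green y hy φ hφ).symm) ha hay hb hby
  classical
  obtain ⟨a, ha, -⟩ := (infinite_E (p := p) hm).exists_notMem_finset ∅
  obtain ⟨b, hb, hab⟩ := (infinite_E (p := p) hm).exists_notMem_finset {a}
  refine ⟨G a b - G' a b, fun x hx y hy hxy => ?_⟩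
  -- The difference is constant in each variable. A third point `z` off both `b` and `y` allows
  -- changing one variable at a time without meeting the diagonal.
  obtain ⟨z, hz, hzn⟩ := (infinite_E (p := p) hm).exists_notMem_finset {b, y}
  simp only [Finset.mem_insert, Finset.mem_singleton, not_or] at hab hzn
  have h1 := key y hy x hx z hz hxy hzn.2
  have h2 := key z hz y hy b hb (Ne.symm hzn.2) (Ne.symm hzn.1)
  have h3 := key b hb z hz a ha hzn.1 (Ne.symm hab)
  rw [hG.symm z hz y hy, hG'.symm z hz y hy] at h1
  rw [hG.symm b hb z hz, hG'.symm b hb z hz] at h2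
  linarith

theorem valuation_eq {t : ℕ} (hx : ‖x‖ = (p : ℝ)⁻¹ ^ t) : x.valuation = t := by
  have hx0 : x ≠ 0 := by rw [← norm_pos_iff, hx]; exact inv_pow_pos t
  have h := Padic.norm_eq_zpow_neg_valuation hx0
  rw [hx, inv_pow, ← zpow_natCast, ← zpow_neg] at h
  have := zpow_right_injective₀ cast_prime_pos one_lt_cast_prime.ne' h
  omega

theorem D_B_eq_closed_form (hx : x ∈ E p m) (hy : y ∈ E p m) (hxy : x ≠ y) :
    D p m (fun z => B p m z y) x =
      -lambda0 p * (p : ℝ) ^ (-|x.valuation - y.valuation|) *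
        (((p : ℝ) + 1) / (((p : ℝ) - 1) * ((p : ℝ) + 1 - U p m y))) := by
  obtain ⟨s, hs, hys⟩ := mem_E_iff.1 hy
  obtain ⟨t, ht, hxt⟩ := mem_E_iff.1 hx
  have h1 : |x.valuation - y.valuation| = ((t + s - 2 * min t s : ℕ) : ℤ) := by
    rw [valuation_eq hxt, valuation_eq hys]
    rcases le_total t s with h | h
    · rw [min_eq_left h, abs_of_nonpos (by omega)]; omega
    · rw [min_eq_right h, abs_of_nonneg (by omega)]; omega
  rw [D_B_eq hs hys ht hxt hxy, tail_zero_div hy, h1, zpow_neg, zpow_natCast, inv_pow]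
  ring

end

end TateCurve

theorem mainTheorem2 (p : ℕ) [Fact p.Prime] (m : ℕ) (hm : 1 ≤ m) :
    -- there is a Green's function of the form `B + C`, with `C` depending only on `|x|` and `|y|`,
    (∃ C : ℝ → ℝ → ℝ, TateCurve.IsGreen p m fun x y => TateCurve.B p m x y + C ‖x‖ ‖y‖) ∧
    -- and every symmetric Green's function is of this form;
    (∀ G : ℚ_[p] → ℚ_[p] → ℝ, TateCurve.IsGreen p m G →
      ∃ C : ℝ → ℝ → ℝ, ∀ x ∈ TateCurve.E p m, ∀ y ∈ TateCurve.E p m, x ≠ y →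
        G x y = TateCurve.B p m x y + C ‖x‖ ‖y‖) ∧
    -- the series in `A` and `B` converge absolutely;
    (∀ y ∈ TateCurve.E p m, Summable fun n : ℕ => |TateCurve.lambda p m (n + 1) y|) ∧
    (∀ x ∈ TateCurve.E p m, ∀ y ∈ TateCurve.E p m,
      Summable fun n : ℕ => |TateCurve.lambda p m (n + 1) y * TateCurve.d p x y ^ (n + 1)|) ∧
    -- off the diagonal, `D` of `B` and of each of its terms is an absolutely convergent integral,
    -- `DB` is the sum of the absolutely convergent series of the terms, and has a closed form;
    (∀ x ∈ TateCurve.E p m, ∀ y ∈ TateCurve.E p m, x ≠ y →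
      TateCurve.DConverges p m (fun z => TateCurve.B p m z y) x ∧
      TateCurve.DConverges p m (fun z => Real.logb p (TateCurve.d p z y)) x ∧
      (∀ n : ℕ, TateCurve.DConverges p m (fun z => TateCurve.d p z y ^ (n + 1)) x) ∧
      (Summable fun n : ℕ => |TateCurve.lambda p m (n + 1) y *
        TateCurve.D p m (fun z => TateCurve.d p z y ^ (n + 1)) x|) ∧
      TateCurve.D p m (fun z => TateCurve.B p m z y) x =
        TateCurve.lambda0 p * TateCurve.D p m (fun z => Real.logb p (TateCurve.d p z y)) x +
          ∑' n : ℕ, TateCurve.lambda p m (n + 1) y *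
            TateCurve.D p m (fun z => TateCurve.d p z y ^ (n + 1)) x ∧
      TateCurve.D p m (fun z => TateCurve.B p m z y) x =
        -TateCurve.lambda0 p * (p : ℝ) ^ (-|x.valuation - y.valuation|) *
          (((p : ℝ) + 1) / (((p : ℝ) - 1) * ((p : ℝ) + 1 - TateCurve.U p m y)))) ∧
    -- in particular `DB(x, y)` depends only on `|x|` and `|y|` off the diagonal.
    (∀ x ∈ TateCurve.E p m, ∀ y ∈ TateCurve.E p m, ∀ x' ∈ TateCurve.E p m,
      ∀ y' ∈ TateCurve.E p m, x ≠ y → x' ≠ y' → ‖x‖ = ‖x'‖ → ‖y‖ = ‖y'‖ →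
      TateCurve.D p m (fun z => TateCurve.B p m z y) x =
        TateCurve.D p m (fun z => TateCurve.B p m z y') x') := by
  obtain ⟨C, hC⟩ := TateCurve.exists_isGreen p hm
  refine ⟨⟨C, hC⟩, fun G hG => ?_, fun y hy => (TateCurve.summable_lambda hy).abs,
    fun x _ y hy => (TateCurve.summable_lambda_mul_pow hy (TateCurve.d_nonneg x y)
      (TateCurve.d_le_one x y)).abs, fun x hx y hy hxy => ?_,
    fun x hx y hy x' hx' y' hy' hxy hxy' hxx hyy => ?_⟩
  · obtain ⟨k, hk⟩ := hG.exists_eq_add_const hm hC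
    exact ⟨fun a b => C a b + k, fun x hx y hy hxy => by rw [hk x hx y hy hxy, add_assoc]⟩
  · have h := TateCurve.hasSum_D_B hx hy hxy
    exact ⟨TateCurve.dConverges_B hx hy hxy, TateCurve.dConverges_logb hx hy hxy,
      fun n => TateCurve.dConverges_pow hx hy hxy (n + 1), h.summable.abs,
      by rw [h.tsum_eq]; ring, TateCurve.D_B_eq_closed_form hx hy hxy⟩
  · obtain ⟨s, -, hs⟩ := TateCurve.mem_E_iff.1 hy
    obtain ⟨t, -, ht⟩ := TateCurve.mem_E_iff.1 hx
    rw [TateCurve.D_B_eq_closed_form hx hy hxy, TateCurve.D_B_eq_closed_form hx' hy' hxy',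
      TateCurve.valuation_eq hs, TateCurve.valuation_eq ht,
      TateCurve.valuation_eq (hyy.symm.trans hs), TateCurve.valuation_eq (hxx.symm.trans ht),
      TateCurve.U, TateCurve.U, hyy]
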